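/- Let $H, G_1,\dots,G_m$ ($m\ge 1$) be real Hilbert spaces. Let $f:H\to\mathbb R$ be convex and differentiable with $L$-Lipschitz gradient, $0<L<\infty$; let $g:H\to(-\infty,+\infty]$ and $h_i:G_i\to(-\infty,+\infty]$ be proper, convex and lower semicontinuous; let $B_i:H\to G_i$ be bounded linear operators. Consider $$\min_{x\in H}\; f(x)+g(x)+\sum_{i=1}^m h_i(B_ix), \tag{1.1}$$ and assume that (1.1) has a solution, i.e. a minimizer at which the objective is finite. Write $\mathrm{prox}_{t\varphi}(v)=\arg\min_x\{\tfrac12\|x-v\|^2+t\varphi(x)\}$ and $\varphi^*(y)=\sup_x\{\langle x,y\rangle-\varphi(x)\}$. Let $\gamma\in(0,2/L)$ and $\sigma,\tau>0$ with $\sigma\tau\sum_{i=1}^m\|B_i\|^2<1$. For $u\in H$, the inner loop started at $(\bar x^0,y_1^0,\dots,y_m^0)\in H\times G_1\times\dots\times G_m$ is, for $j=0,1,2,\dots$, $$\bar x^{j+1}=\mathrm{prox}_{\frac{\tau\gamma}{1+\tau}g}\Big(\tfrac{\bar x^{j}-\tau\sum_{i}B_i^*y_i^{j}+\tau u}{1+\tau}\Big),\qquad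 y_i^{j+1}=\gamma\,\mathrm{prox}_{\frac{\sigma}{\gamma}h_i^*}\Big(\tfrac1\gamma\big(y_i^{j}+\sigma B_i(2\bar x^{j+1}-\bar x^{j})\big)\Big).$$ It addresses the inner subproblem $\min_x \tfrac12\|x-u\|^2+\gamma\big(g(x)+\sum_i h_i(B_ix)\big)$, whose solution is $p(u)=\mathrm{prox}_{\gamma(g+\sum_i h_i\circ B_i)}(u)$, and whose dual is to maximize $D_u(y)=\inf_z\{\tfrac12\|z-u\|^2+\gamma g(z)+\sum_i\langle B_iz,y_i\rangle\}-\sum_i\gamma h_i^*(y_i/\gamma)$. Its primal-dual gap at $(x,y)$ is $\tfrac12\|x-u\|^2+\gamma\big(g(x)+\sum_i h_i(B_ix)\big)-D_u(y)$. The nested primal-dual forward-backward algorithm with tolerances $\delta_k>0$, $\sum_k\sqrt{\delta_k}<\infty$, starts from arbitrary $x^0,\bar x^0\in H$ and $y^0=(y_1^0,\dots,y_m^0)$. For $k=0,1,2,\dots$ it sets $u^k=x^k-\gamma\nabla f(x^k)$ and runs the inner loop with $u=u^k$, started at $(\bar x^0,y^0)$ for $k=0$ and at any point for $k\ge1$ (for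 instance at the last inner iterate, or again at $(\bar x^0,y^0)$). The inner loop is left after some finite number $j+1\ge1$ of iterations at which the primal-dual gap at $(\bar x^{j+1},y^{j+1})$ is less than $\delta_k$, or at which $\|\bar x^{j+1}-p(u^k)\|^2<\delta_k$, and then $x^{k+1}=\bar x^{j+1}$; or it is run to convergence, and then $x^{k+1}=\lim_j\bar x^{j}$ (limit in norm). Then: 1. For every $u\in H$, every starting point and every $\delta>0$, some inner iterate satisfies $\|\bar x^{j+1}-p(u)\|^2<\delta$; and if all $h_i$ are finite everywhere, the primal-dual gap at some inner iterate $(\bar x^{j+1},y^{j+1})$ is less than $\delta$. Moreover, if the gap vanishes at $(p(u),y)$ for some $y$ (that is, the dual of the inner subproblem has a solution), then $\bar x^{j}\to p(u)$ in norm. 2. Every sequence $(x^k)$ of outer iterates generated by the algorithm converges weakly to a solution of (1.1); if $H$ is finite-dimensional, it converges in norm. -/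

import Mathlib

open Filter Topology

noncomputable section

namespace PDFB

variable {E : Type*} [NormedAddCommGroup E] [InnerProductSpace ℝ E]

/-- The class `Γ₀(E)` of proper, lower semicontinuous, convex functions `E → (-∞, +∞]`.
Convexity is convexity of the epigraph. -/
structure GammaZero (φ : E → EReal) : Prop where
  ne_bot : ∀ x, φ x ≠ ⊥
  proper : ∃ x, φ x ≠ ⊤
  lsc : LowerSemicontinuous φ
  convex : Convex ℝ {p : E × ℝ | φ p.1 ≤ (p.2 : EReal)}

/-- `p` is a global minimizer of `φ`, with a value different from `+∞`. -/
def IsMinimizer (φ : E → EReal) (p : E) : Prop :=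
  φ p ≠ ⊤ ∧ ∀ z, φ p ≤ φ z

/-- The function `x ↦ ‖x - v‖² / 2 + t φ(x)`. -/
def proxObjective (t : ℝ) (φ : E → EReal) (v x : E) : EReal :=
  ((‖x - v‖ ^ 2 / 2 : ℝ) : EReal) + (t : EReal) * φ x

/-- The proximity operator `prox_{tφ}(v) = argmin_x { ‖x - v‖² / 2 + t φ(x) }`
(for `t > 0` and `φ ∈ Γ₀(E)`, `E` complete, the minimizer exists and is unique). -/
def prox (t : ℝ) (φ : E → EReal) (v : E) : E :=
  Classical.epsilon (IsMinimizer (proxObjective t φ v))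

/-- The Fenchel conjugate `φ*(y) = sup_x { ⟨x, y⟩ - φ(x) }`. -/
def conj (φ : E → EReal) (y : E) : EReal :=
  ⨆ x : E, ((inner ℝ x y : ℝ) : EReal) - φ x

/-- Weak convergence of a sequence to `a`. -/
def WeaklyTendsto (x : ℕ → E) (a : E) : Prop :=
  ∀ w : E, Tendsto (fun k => (inner ℝ (x k) w : ℝ)) atTop (𝓝 (inner ℝ a w))

variable {H : Type*} [NormedAddCommGroup H] [InnerProductSpace ℝ H] [CompleteSpace H]
variable {m : ℕ} {G : Fin m → Type*} [∀ i, NormedAddCommGroup (G i)]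
  [∀ i, InnerProductSpace ℝ (G i)] [∀ i, CompleteSpace (G i)]

/-- The nonsmooth part `x ↦ g(x) + ∑ᵢ hᵢ(Bᵢ x)`. -/
def nonsmooth (g : H → EReal) (h : ∀ i, G i → EReal) (B : ∀ i, H →L[ℝ] G i) (x : H) : EReal :=
  g x + ∑ i, h i (B i x)

/-- The objective `x ↦ f(x) + g(x) + ∑ᵢ hᵢ(Bᵢ x)` of the composite problem. -/
def objective (f : H → ℝ) (g : H → EReal) (h : ∀ i, G i → EReal) (B : ∀ i, H →L[ℝ] G i)
    (x : H) : EReal :=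
  (f x : EReal) + g x + ∑ i, h i (B i x)

/-- One inner iteration, mapping `(x̄ʲ, (yᵢʲ)ᵢ)` to `(x̄ʲ⁺¹, (yᵢʲ⁺¹)ᵢ)`. -/
def innerStep (γ σ τ : ℝ) (g : H → EReal) (h : ∀ i, G i → EReal) (B : ∀ i, H →L[ℝ] G i)
    (u : H) (s : H × (∀ i, G i)) : H × (∀ i, G i) :=
  let xnew : H := prox (τ * γ / (1 + τ)) g
    ((1 + τ)⁻¹ • (s.1 - τ • (∑ i, ContinuousLinearMap.adjoint (B i) (s.2 i)) + τ • u))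
  (xnew, fun i => γ • prox (σ / γ) (conj (h i))
    (γ⁻¹ • (s.2 i + σ • B i ((2 : ℝ) • xnew - s.1))))

/-- Objective of the dual of the inner subproblem
`min_x ‖x - u‖² / 2 + γ (g(x) + ∑ᵢ hᵢ(Bᵢ x))`: minimization over the primal variable in the
Lagrangian `‖z - u‖² / 2 + γ g(z) + ∑ᵢ ⟨Bᵢ z, yᵢ⟩ - ∑ᵢ γ hᵢ*(yᵢ / γ)`. -/
def dualObjective (γ : ℝ) (g : H → EReal) (h : ∀ i, G i → EReal) (B : ∀ i, H →L[ℝ] G i)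
    (u : H) (y : ∀ i, G i) : EReal :=
  (⨅ z : H, proxObjective γ g u z + ((∑ i, (inner ℝ (B i z) (y i) : ℝ) : ℝ) : EReal))
    - ∑ i, (γ : EReal) * conj (h i) (γ⁻¹ • y i)

/-- The primal-dual gap of the inner subproblem at `(x, y)`. -/
def gap (γ : ℝ) (g : H → EReal) (h : ∀ i, G i → EReal) (B : ∀ i, H →L[ℝ] G i)
    (u : H) (s : H × (∀ i, G i)) : EReal :=
  proxObjective γ (nonsmooth g h B) u s.1 - dualObjective γ g h B u s.2

/-- Admissible ends of the inner loop with iterates `s 0, s 1, …` and tolerance `δ`: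
the loop is left after finitely many (at least one) iterations, either because the primal-dual
gap is below `δ` or because the squared distance to the exact solution of the inner subproblem
is below `δ`; or the loop is run to convergence and its limit is returned. -/
def InnerOutput (γ : ℝ) (g : H → EReal) (h : ∀ i, G i → EReal) (B : ∀ i, H →L[ℝ] G i)
    (u : H) (s : ℕ → H × (∀ i, G i)) (δ : ℝ) (xout : H) : Prop :=
  (∃ j : ℕ, xout = (s (j + 1)).1 ∧
    (gap γ g h B u (s (j + 1)) < (δ : EReal) ∨
      ‖(s (j + 1)).1 - prox γ (nonsmooth g h B) u‖ ^ 2 < δ)) ∨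
  Tendsto (fun j => (s j).1) atTop (𝓝 xout)

/-- The sequences `(x^k)`, `(u^k)` and, for every `k`, the inner iterates
`s k j = (x̄^{j}, (y_i^{j})_i)` are generated by the algorithm from `(x⁰, x̄⁰, y⁰)` with
tolerances `δ k`. The starting point `s k 0` of the later inner loops (`k ≥ 1`) is left free,
which covers warm starts as well as restarts from `(x̄⁰, y⁰)`. -/
structure GeneratedBy (γ σ τ : ℝ) (f : H → ℝ) (g : H → EReal) (h : ∀ i, G i → EReal)
    (B : ∀ i, H →L[ℝ] G i) (x0 xbar0 : H) (y0 : ∀ i, G i) (δ : ℕ → ℝ)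
    (x u : ℕ → H) (s : ℕ → ℕ → H × (∀ i, G i)) : Prop where
  init_outer : x 0 = x0
  init_inner : s 0 0 = (xbar0, y0)
  forward : ∀ k, u k = x k - γ • gradient f (x k)
  inner_step : ∀ k j, s k (j + 1) = innerStep γ σ τ g h B (u k) (s k j)
  output : ∀ k, InnerOutput γ g h B (u k) (s k) (δ k) (x (k + 1))

end PDFB

end

/-! Stack the `B i` into one operator `K` into the Hilbert sum and put F(q) = ∑ hᵢ(qᵢ). An inner
iteration is then a proximal point step in the metric `pdForm`, which is coercive because στ∑‖Bᵢ‖² <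
1. The inner dual need not have a solution, so the usual Fejér argument with a saddle point is
unavailable. Strong convexity in the primal variable, however, makes the value function of the
perturbed problem lower semicontinuous at 0, and Hahn–Banach yields an ε-optimal dual point for
every ε > 0 (`exists_approxDual`). Relative to such a point a step decreases the metric distance by
at least ‖x' - p‖² - 2ε (`PDStep.fejer`). Summing over many steps forces some iterate close to p;
with ε = 0 the squared distances are summable and the iterates converge. If all hᵢ are finite they
are continuous by Baire, the ε-optimal dual points stay bounded, and some iterate has small steps
and bounded dual variable, hence small gap.

For the outer loop, weak duality and strong convexity turn gap < δ into squared distance < 2δ, and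
all exits of the inner loop give an error of at most √2·√δ (`InnerOutput.norm_sub_le`). The outer
sequence is therefore a Krasnosel'skii–Mann iteration with summable errors for the forward-backward
operator, which is averaged by Baillon–Haddad (`isAveraged_forwardBackward`) and whose fixed points
are the solutions. -/

noncomputable section
namespace PDFB

/-! ### Extended-real inequalities expressed through real upper bounds. -/

section ERealLemmas

theorem coe_sum_ereal {ι : Type*} (s : Finset ι) (f : ι → ℝ) :
    ((∑ i ∈ s, f i : ℝ) : EReal) = ∑ i ∈ s, (f i : EReal) := by
  classical
  induction s using Finset.induction_on with
  | empty => simp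
  | insert a s ha ih => rw [Finset.sum_insert ha, Finset.sum_insert ha, EReal.coe_add, ih]

theorem exists_coe_of_le {a : EReal} (ha : a ≠ ⊥) {r : ℝ} (h : a ≤ r) :
    ∃ a' : ℝ, a = a' ∧ a' ≤ r := by
  lift a to ℝ using ⟨fun h' => by simp [h'] at h, ha⟩
  exact ⟨a, rfl, by exact_mod_cast h⟩

theorem exists_coe_of_add_le {a b : EReal} (ha : a ≠ ⊥) (hb : b ≠ ⊥) {r : ℝ}
    (h : a + b ≤ r) : ∃ a' b' : ℝ, a = a' ∧ b = b' ∧ a' + b' ≤ r := by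
  have ha' : a ≠ ⊤ := by
    rintro rfl
    rw [EReal.top_add_of_ne_bot hb] at h
    simp at h
  have hb' : b ≠ ⊤ := by
    rintro rfl
    rw [EReal.add_top_of_ne_bot ha] at h
    simp at h
  lift a to ℝ using ⟨ha', ha⟩
  lift b to ℝ using ⟨hb', hb⟩
  exact ⟨a, b, rfl, rfl, by exact_mod_cast h⟩

theorem sum_ereal_ne_bot {ι : Type*} (s : Finset ι) {a : ι → EReal} (ha : ∀ i, a i ≠ ⊥) :
    ∑ i ∈ s, a i ≠ ⊥ := by
  classical
  induction s using Finset.induction_on with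
  | empty => simp
  | insert i s hi ih =>
    rw [Finset.sum_insert hi, Ne, EReal.add_eq_bot_iff]
    exact not_or.2 ⟨ha i, ih⟩

theorem exists_coe_of_sum_le {ι : Type*} [Fintype ι] {a : ι → EReal} (ha : ∀ i, a i ≠ ⊥) {r : ℝ}
    (h : ∑ i, a i ≤ r) : ∃ a' : ι → ℝ, (∀ i, a i = a' i) ∧ ∑ i, a' i ≤ r := by
  classical
  have ht : ∀ i, a i ≠ ⊤ := by
    intro i hi
    rw [← Finset.add_sum_erase _ _ (Finset.mem_univ i), hi,
      EReal.top_add_of_ne_bot (sum_ereal_ne_bot _ ha)] at h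
    simp at h
  refine ⟨fun i => (a i).toReal, fun i => (EReal.coe_toReal (ht i) (ha i)).symm, ?_⟩
  rw [← EReal.coe_le_coe_iff, coe_sum_ereal]
  simpa only [EReal.coe_toReal (ht _) (ha _)] using h

theorem coe_mul_le_coe_iff {t : ℝ} (ht : 0 < t) {a : EReal} {r : ℝ} :
    (t : EReal) * a ≤ r ↔ a ≤ ((r / t : ℝ) : EReal) := by
  induction a with
  | bot => simp [EReal.coe_mul_bot_of_pos ht]
  | top => simp [EReal.coe_mul_top_of_pos ht]
  | coe a =>
    rw [← EReal.coe_mul, EReal.coe_le_coe_iff, EReal.coe_le_coe_iff, le_div_iff₀ ht, mul_comm]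

theorem coe_add_le_coe_iff {t : ℝ} {a : EReal} {r : ℝ} :
    (t : EReal) + a ≤ r ↔ a ≤ ((r - t : ℝ) : EReal) := by
  induction a with
  | bot => simp
  | top => simp [-EReal.coe_sub]
  | coe a =>
    rw [← EReal.coe_add, EReal.coe_le_coe_iff, EReal.coe_le_coe_iff, le_sub_iff_add_le, add_comm]

theorem le_of_forall_coe_le {a b : EReal} (h : ∀ r : ℝ, b ≤ r → a ≤ r) : a ≤ b :=
  EReal.le_of_forall_lt_iff_le.1 fun z hz => h z hz.le

end ERealLemmas

/-! ### Convex lower semicontinuous functions and attainment of strongly convex infima. -/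

/-- Convex lower semicontinuous functions with values in `(-∞, +∞]`, possibly identically `+∞`. -/
structure ConvLsc {V : Type*} [NormedAddCommGroup V] [NormedSpace ℝ V] (φ : V → EReal) :
    Prop where
  ne_bot : ∀ x, φ x ≠ ⊥
  lsc : LowerSemicontinuous φ
  convex : Convex ℝ {p : V × ℝ | φ p.1 ≤ (p.2 : EReal)}

theorem GammaZero.convLsc {E : Type*} [NormedAddCommGroup E] [InnerProductSpace ℝ E]
    {φ : E → EReal} (h : GammaZero φ) : ConvLsc φ := ⟨h.ne_bot, h.lsc, h.convex⟩

namespace ConvLsc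

variable {V V' : Type*} [NormedAddCommGroup V] [NormedSpace ℝ V]
  [NormedAddCommGroup V'] [NormedSpace ℝ V']

theorem convex_le {φ : V → EReal} (h : ConvLsc φ) {x y : V} {r s a b : ℝ} (hx : φ x ≤ r)
    (hy : φ y ≤ s) (ha : 0 ≤ a) (hb : 0 ≤ b) (hab : a + b = 1) :
    φ (a • x + b • y) ≤ ((a * r + b * s : ℝ) : EReal) :=
  h.convex (x := (x, r)) hx (y := (y, s)) hy ha hb hab

theorem isClosed_epigraph {φ : V → EReal} (h : ConvLsc φ) :
    IsClosed {p : V × ℝ | φ p.1 ≤ (p.2 : EReal)} :=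
  h.lsc.isClosed_epigraph.preimage
    (continuous_fst.prodMk (continuous_coe_real_ereal.comp continuous_snd))

theorem add {φ ψ : V → EReal} (hφ : ConvLsc φ) (hψ : ConvLsc ψ) :
    ConvLsc (fun x => φ x + ψ x) where
  ne_bot x := by
    rw [Ne, EReal.add_eq_bot_iff]
    exact not_or.2 ⟨hφ.ne_bot x, hψ.ne_bot x⟩
  lsc := hφ.lsc.add' hψ.lsc fun x =>
    EReal.continuousAt_add (Or.inr (hψ.ne_bot x)) (Or.inl (hφ.ne_bot x))
  convex := by
    rintro ⟨x, r⟩ hx ⟨y, s⟩ hy a b ha hb hab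
    obtain ⟨x1, x2, hx1, hx2, hxr⟩ := exists_coe_of_add_le (hφ.ne_bot x) (hψ.ne_bot x) hx
    obtain ⟨y1, y2, hy1, hy2, hys⟩ := exists_coe_of_add_le (hφ.ne_bot y) (hψ.ne_bot y) hy
    have h1 := hφ.convex_le hx1.le hy1.le ha hb hab
    have h2 := hψ.convex_le hx2.le hy2.le ha hb hab
    refine (add_le_add h1 h2).trans ?_
    rw [← EReal.coe_add, EReal.coe_le_coe_iff]
    simp only [Prod.smul_mk, Prod.mk_add_mk, smul_eq_mul]
    nlinarith [mul_le_mul_of_nonneg_left hxr ha, mul_le_mul_of_nonneg_left hys hb]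

theorem comp {φ : V' → EReal} (hφ : ConvLsc φ) (A : V →L[ℝ] V') : ConvLsc (fun x => φ (A x)) where
  ne_bot x := hφ.ne_bot _
  lsc := hφ.lsc.comp A.continuous
  convex := by
    rintro ⟨x, r⟩ hx ⟨y, s⟩ hy a b ha hb hab
    have := hφ.convex_le (x := A x) (y := A y) hx hy ha hb hab
    simpa using this

theorem zero : ConvLsc (fun _ : V => (0 : EReal)) where
  ne_bot x := by simp
  lsc := lowerSemicontinuous_const
  convex := by
    rintro ⟨x, r⟩ hx ⟨y, s⟩ hy a b ha hb hab
    have hr : 0 ≤ r := by simpa using hx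
    have hs : 0 ≤ s := by simpa using hy
    have : (0 : ℝ) ≤ a * r + b * s := by positivity
    exact EReal.coe_nonneg.2 this

theorem sum {ι : Type*} (s : Finset ι) {φ : ι → V → EReal} (h : ∀ i, ConvLsc (φ i)) :
    ConvLsc (fun x => ∑ i ∈ s, φ i x) := by
  classical
  induction s using Finset.induction_on with
  | empty => simpa using zero
  | insert i s hi ih => simpa only [Finset.sum_insert hi] using (h i).add ih

/-- A convex lower semicontinuous function is bounded below by a conical function. -/
theorem exists_lower_bound {φ : V → EReal} (h : ConvLsc φ) (x₀ : V) (hx₀ : φ x₀ ≠ ⊤) :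
    ∃ c C : ℝ, 0 ≤ C ∧ ∀ x r, φ x ≤ ((r : ℝ) : EReal) → c - C * ‖x - x₀‖ ≤ r := by
  obtain ⟨a, ha⟩ : ∃ a : ℝ, φ x₀ = a :=
    ⟨_, (EReal.coe_toReal hx₀ (h.ne_bot x₀)).symm⟩
  have h1 : ((a - 1 : ℝ) : EReal) < φ x₀ := by
    rw [ha]; exact_mod_cast sub_one_lt a
  obtain ⟨ρ, hρ, hball⟩ := Metric.eventually_nhds_iff.1 (h.lsc x₀ _ h1)
  refine ⟨a - 1, 2 / ρ, by positivity, fun x r hx => ?_⟩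
  by_contra! hlt
  have hn : 0 ≤ 2 / ρ * ‖x - x₀‖ := by positivity
  by_cases hd : ‖x - x₀‖ < ρ
  · have := (hball (y := x) (by rwa [dist_eq_norm])).trans_le hx
    have : a - 1 < r := by exact_mod_cast this
    linarith
  · push Not at hd
    set d := ‖x - x₀‖ with hd_def
    have hdp : 0 < d := hρ.trans_le hd
    have ht0 : 0 ≤ ρ / (2 * d) := by positivity
    have ht1 : ρ / (2 * d) ≤ 1 := by rw [div_le_one (by positivity)]; linarith
    -- Far from `x₀`, test at the point of the segment from `x₀` to `x` at distance ρ/2 from `x₀`: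
    -- it lies in the ball where φ > a - 1, which gives the slope 2/ρ.
    have h2 := h.convex_le hx ha.le ht0 (sub_nonneg.2 ht1) (by ring)
    have h3 : dist ((ρ / (2 * d)) • x + (1 - ρ / (2 * d)) • x₀) x₀ < ρ := by
      rw [dist_eq_norm, show (ρ / (2 * d)) • x + (1 - ρ / (2 * d)) • x₀ - x₀
        = (ρ / (2 * d)) • (x - x₀) by module, norm_smul, Real.norm_of_nonneg ht0, ← hd_def]
      rw [show ρ / (2 * d) * d = ρ / 2 by field_simp]
      linarith
    have h4 := (hball h3).trans_le h2
    have h5 : a - 1 < ρ / (2 * d) * r + (1 - ρ / (2 * d)) * a := by exact_mod_cast h4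
    have h6 : ρ / (2 * d) * r < ρ / (2 * d) * (a - 1 - 2 / ρ * d) :=
      mul_lt_mul_of_pos_left hlt (by positivity)
    have h7 : ρ / (2 * d) * (2 / ρ * d) = 1 := by field_simp
    nlinarith

/-- Lower semicontinuity at w = 0 of the value function w ↦ inf_x ‖x - u‖²/2 + γ Φ(x, w), together
with attainment. By the parallelogram law, almost optimal pairs with w → 0 have Cauchy primal parts,
and the closed epigraph passes to the limit. Upper bounds are solved for Φ to keep the quadratic
part real. The same lemma serves for the existence of proximal points and for duality. -/
theorem exists_limit_minimizer {X W : Type*} [NormedAddCommGroup X] [InnerProductSpace ℝ X]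
    [CompleteSpace X] [NormedAddCommGroup W] [NormedSpace ℝ W] {Φ : X × W → EReal}
    (hΦ : ConvLsc Φ) {γ : ℝ} (hγ : 0 < γ) (u : X) {r₀ : ℝ}
    (hr₀ : ∀ ρ > 0, ∃ x w, ‖w‖ < ρ ∧ Φ (x, w) ≤ (((r₀ - ‖x - u‖ ^ 2 / 2) / γ : ℝ) : EReal)) :
    ∃ x r, Φ (x, 0) ≤ (((r - ‖x - u‖ ^ 2 / 2) / γ : ℝ) : EReal) ∧
      ∀ r' : ℝ, (∀ ρ > 0, ∃ x w, ‖w‖ < ρ ∧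
        Φ (x, w) ≤ (((r' - ‖x - u‖ ^ 2 / 2) / γ : ℝ) : EReal)) → r ≤ r' := by
  set S : Set ℝ := {r' : ℝ | ∀ ρ > 0, ∃ x w, ‖w‖ < ρ ∧
        Φ (x, w) ≤ (((r' - ‖x - u‖ ^ 2 / 2) / γ : ℝ) : EReal)} with hS
  have hmono : ∀ {r r' : ℝ} (x : X) (w : W), r ≤ r' →
      Φ (x, w) ≤ (((r - ‖x - u‖ ^ 2 / 2) / γ : ℝ) : EReal) →
      Φ (x, w) ≤ (((r' - ‖x - u‖ ^ 2 / 2) / γ : ℝ) : EReal) := fun x w hr h =>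
    h.trans (EReal.coe_le_coe_iff.2 (by gcongr))
  have hSup : ∀ {r r' : ℝ}, r ∈ S → r ≤ r' → r' ∈ S := fun hr hrr ρ hρ => by
    obtain ⟨x, w, hw, h⟩ := hr ρ hρ
    exact ⟨x, w, hw, hmono x w hrr h⟩
  have hbdd : BddBelow S := by
    obtain ⟨x₁, w₁, hw₁, h₁⟩ := hr₀ 1 one_pos
    obtain ⟨c, C, hC, hlow⟩ := hΦ.exists_lower_bound (x₁, w₁)
      (ne_top_of_le_ne_top (EReal.coe_ne_top _) h₁)
    -- Minimum over t = ‖x - u‖ of t²/2 plus γ times the conical lower bound; the 2 bounds ‖w - w₁‖,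
    -- both norms being below 1.
    refine ⟨γ * (c - C * (‖u - x₁‖ + 2)) - (γ * C) ^ 2 / 2, fun r hr => ?_⟩
    obtain ⟨x, w, hw, h⟩ := hr 1 one_pos
    have h2 := hlow _ _ h
    have h3 : ‖((x, w) : X × W) - (x₁, w₁)‖ ≤ ‖x - u‖ + (‖u - x₁‖ + 2) := by
      rw [Prod.mk_sub_mk, Prod.norm_mk, max_le_iff]
      constructor
      · have := norm_sub_le_norm_sub_add_norm_sub x u x₁
        linarith
      · have := norm_sub_le w w₁
        have := norm_nonneg (x - u)
        have := norm_nonneg (u - x₁)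
        linarith
    rw [le_div_iff₀ hγ] at h2
    have h4 := mul_le_mul_of_nonneg_left h3 (mul_nonneg hγ.le hC)
    nlinarith [sq_nonneg (‖x - u‖ - γ * C)]
  set R := sInf S with hR
  have hRS : ∀ {η : ℝ}, 0 < η → R + η ∈ S := fun {η} hη => by
    obtain ⟨r, hr, hlt⟩ := exists_lt_of_csInf_lt (s := S) ⟨r₀, hr₀⟩ (lt_add_of_pos_right (sInf S) hη)
    exact hSup hr hlt.le
  have hpos : ∀ n : ℕ, (0 : ℝ) < 1 / ((n : ℝ) + 1) := fun n => Nat.one_div_pos_of_nat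
  choose x w hw hxw using fun n : ℕ => hRS (hpos n) (1 / ((n : ℝ) + 1)) (hpos n)
  have hlim : Tendsto (fun n : ℕ => 1 / ((n : ℝ) + 1)) atTop (𝓝 0) :=
    tendsto_one_div_add_atTop_nhds_zero_nat
  have hcauchy : CauchySeq x := by
    rw [Metric.cauchySeq_iff]
    intro ε hε
    -- The midpoint of two almost optimal pairs gains ‖x m - x n‖²/8; it cannot reach the level R -
    -- ε²/16, and the excess over R is below ε²/16, so ‖x m - x n‖² < ε².
    have hη : R - ε ^ 2 / 16 ∉ S := fun h => by
      have := csInf_le hbdd h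
      have : 0 < ε ^ 2 / 16 := by positivity
      linarith
    have hη' : ¬ ∀ ρ > 0, ∃ x w, ‖w‖ < ρ ∧
        Φ (x, w) ≤ (((R - ε ^ 2 / 16 - ‖x - u‖ ^ 2 / 2) / γ : ℝ) : EReal) := hη
    push Not at hη'
    obtain ⟨ρ, hρ, hρ'⟩ := hη'
    obtain ⟨N, hN⟩ := eventually_atTop.1
      ((hlim.eventually (gt_mem_nhds hρ)).and
        (hlim.eventually (gt_mem_nhds (show 0 < ε ^ 2 / 16 by positivity))))
    refine ⟨N, fun m hm n hn => ?_⟩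
    obtain ⟨hm1, hm2⟩ := hN m hm
    obtain ⟨hn1, hn2⟩ := hN n hn
    have hmid := hΦ.convex_le (hxw m) (hxw n) (show (0 : ℝ) ≤ 1 / 2 by norm_num)
      (show (0 : ℝ) ≤ 1 / 2 by norm_num) (by norm_num)
    have hwn : ‖(1 / 2 : ℝ) • w m + (1 / 2 : ℝ) • w n‖ < ρ := by
      refine (norm_add_le _ _).trans_lt ?_
      rw [norm_smul, norm_smul, Real.norm_of_nonneg (by norm_num)]
      linarith [hw m, hw n]
    have h5 := (hρ' _ _ hwn).trans_le hmid
    rw [EReal.coe_lt_coe_iff] at h5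
    have hid : ‖(1 / 2 : ℝ) • x m + (1 / 2 : ℝ) • x n - u‖ ^ 2
        = (‖x m - u‖ ^ 2 + ‖x n - u‖ ^ 2) / 2 - ‖x m - x n‖ ^ 2 / 4 := by
      have e1 : (1 / 2 : ℝ) • x m + (1 / 2 : ℝ) • x n - u
          = (1 / 2 : ℝ) • ((x m - u) + (x n - u)) := by module
      have e2 : x m - x n = (x m - u) - (x n - u) := by abel
      have hp := parallelogram_law_with_norm ℝ (x m - u) (x n - u)
      rw [e1, e2, norm_smul, mul_pow, Real.norm_of_nonneg (by norm_num)]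
      nlinarith
    have h6 : ‖x m - x n‖ ^ 2 < ε ^ 2 := by
      have e : 1 / 2 * ((R + 1 / (↑m + 1) - ‖x m - u‖ ^ 2 / 2) / γ) +
          1 / 2 * ((R + 1 / (↑n + 1) - ‖x n - u‖ ^ 2 / 2) / γ) =
          ((R + 1 / (↑m + 1) - ‖x m - u‖ ^ 2 / 2) / 2 +
            (R + 1 / (↑n + 1) - ‖x n - u‖ ^ 2 / 2) / 2) / γ := by ring
      rw [e, div_lt_div_iff_of_pos_right hγ] at h5
      simp only [Prod.smul_mk] at h5
      rw [hid] at h5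
      linarith
    rw [dist_eq_norm]
    exact lt_of_pow_lt_pow_left₀ 2 hε.le h6
  obtain ⟨x', hx'⟩ := cauchySeq_tendsto_of_complete hcauchy
  have hw' : Tendsto w atTop (𝓝 0) :=
    squeeze_zero_norm (fun n => (hw n).le) hlim
  refine ⟨x', R, ?_, fun r' hr' => csInf_le hbdd hr'⟩
  have htend : Tendsto (fun n => (((x n, w n) : X × W),
      (R + 1 / ((n : ℝ) + 1) - ‖x n - u‖ ^ 2 / 2) / γ)) atTop
      (𝓝 ((x', 0), (R + 0 - ‖x' - u‖ ^ 2 / 2) / γ)) :=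
    (hx'.prodMk_nhds hw').prodMk_nhds
      (((tendsto_const_nhds.add hlim).sub
        (((hx'.sub_const u).norm.pow 2).div_const 2)).div_const γ)
  have := hΦ.isClosed_epigraph.mem_of_tendsto htend (Eventually.of_forall hxw)
  simpa using this

end ConvLsc
end PDFB
end

/-! ### Subgradients, proximity operators and conjugates. -/

noncomputable section
namespace PDFB

variable {E : Type*} [NormedAddCommGroup E] [InnerProductSpace ℝ E]

/-- `ξ` is a subgradient of `φ` at `x`, and `a` is the (finite) value of `φ` there. -/
def IsSubgrad (φ : E → EReal) (x : E) (a : ℝ) (ξ : E) : Prop :=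
  φ x = a ∧ ∀ (z : E) (r : ℝ), φ z ≤ r → a + inner ℝ ξ (z - x) ≤ r

theorem IsSubgrad.monotone {φ : E → EReal} {x x' ξ ξ' : E} {a a' : ℝ} (h : IsSubgrad φ x a ξ)
    (h' : IsSubgrad φ x' a' ξ') : 0 ≤ (inner ℝ (ξ - ξ') (x - x') : ℝ) := by
  have h1 := h.2 x' a' h'.1.le
  have h2 := h'.2 x a h.1.le
  have e : (inner ℝ ξ (x' - x) : ℝ) = - inner ℝ ξ (x - x') := by
    rw [← inner_neg_right, neg_sub]
  rw [inner_sub_left]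
  linarith

theorem nonneg_of_forall_mul_add_sq {A B : ℝ}
    (h : ∀ t : ℝ, 0 < t → t ≤ 1 → 0 ≤ t * A + t ^ 2 * B) : 0 ≤ A := by
  have hlim : Tendsto (fun t : ℝ => A + t * B) (𝓝[>] 0) (𝓝 (A + 0 * B)) := by
    refine Tendsto.mono_left ?_ nhdsWithin_le_nhds
    exact (continuous_const.add (continuous_id.mul continuous_const)).tendsto 0
  rw [zero_mul, add_zero] at hlim
  refine ge_of_tendsto hlim ?_
  filter_upwards [Ioc_mem_nhdsGT (zero_lt_one' ℝ)] with t ht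
  have := h t ht.1 ht.2
  have e : t * A + t ^ 2 * B = t * (A + t * B) := by ring
  rw [e] at this
  exact nonneg_of_mul_nonneg_right this ht.1

theorem norm_sub_sq_expand (x z v : E) :
    ‖z - v‖ ^ 2 = ‖x - v‖ ^ 2 + 2 * inner ℝ (x - v) (z - x) + ‖z - x‖ ^ 2 := by
  rw [← norm_add_sq_real]
  congr 2
  abel

/-- The extra ‖z - p‖²/2 is the 1-strong convexity of the quadratic. It yields uniqueness of
proximal points here and the passage from gap to distance later. -/
theorem IsSubgrad.prox_quadratic_growth {φ : E → EReal} {t : ℝ} (ht : 0 < t) {v p : E} {a : ℝ}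
    (h : IsSubgrad φ p a (t⁻¹ • (v - p))) {z : E} {r : ℝ} (hz : φ z ≤ r) :
    ‖p - v‖ ^ 2 / 2 + t * a + ‖z - p‖ ^ 2 / 2 ≤ ‖z - v‖ ^ 2 / 2 + t * r := by
  have h1 := h.2 z r hz
  rw [inner_smul_left, RCLike.conj_to_real, ← neg_sub p v, inner_neg_left] at h1
  have h2 := mul_le_mul_of_nonneg_left h1 ht.le
  rw [mul_add, ← mul_assoc, mul_inv_cancel₀ ht.ne', one_mul] at h2
  have := norm_sub_sq_expand p z v
  linarith

theorem proxObjective_le_coe_iff {E : Type*} [NormedAddCommGroup E] {t : ℝ} (ht : 0 < t) {φ : E → EReal} {v z : E} {r : ℝ} :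
    proxObjective t φ v z ≤ r ↔ φ z ≤ (((r - ‖z - v‖ ^ 2 / 2) / t : ℝ) : EReal) := by
  rw [proxObjective, coe_add_le_coe_iff, coe_mul_le_coe_iff ht]

theorem proxObjective_of_eq {E : Type*} [NormedAddCommGroup E] {t : ℝ} {φ : E → EReal} {v z : E} {a : ℝ} (h : φ z = a) :
    proxObjective t φ v z = ((‖z - v‖ ^ 2 / 2 + t * a : ℝ) : EReal) := by
  rw [proxObjective, h]
  norm_cast

/-- `prox` is a choice among minimizers: the subgradient condition shows that one exists, and
quadratic growth shows that the chosen one is `p`. -/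
theorem IsSubgrad.prox_eq {φ : E → EReal} {t : ℝ} (ht : 0 < t) {v p : E} {a : ℝ}
    (h : IsSubgrad φ p a (t⁻¹ • (v - p))) : prox t φ v = p := by
  have hP := proxObjective_of_eq (t := t) (v := v) h.1
  have hmin : IsMinimizer (proxObjective t φ v) p := by
    refine ⟨by rw [hP]; exact EReal.coe_ne_top _, fun z => le_of_forall_coe_le fun r hr => ?_⟩
    have := h.prox_quadratic_growth ht ((proxObjective_le_coe_iff ht).1 hr)
    rw [hP, EReal.coe_le_coe_iff]
    have e : t * ((r - ‖z - v‖ ^ 2 / 2) / t) = r - ‖z - v‖ ^ 2 / 2 := by field_simp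
    nlinarith [sq_nonneg ‖z - p‖]
  have hspec : IsMinimizer (proxObjective t φ v) (prox t φ v) := Classical.epsilon_spec ⟨p, hmin⟩
  have h1 := hspec.2 p
  rw [hP, proxObjective_le_coe_iff ht] at h1
  have h2 := h.prox_quadratic_growth ht h1
  have e : t * ((‖p - v‖ ^ 2 / 2 + t * a - ‖prox t φ v - v‖ ^ 2 / 2) / t)
    = ‖p - v‖ ^ 2 / 2 + t * a - ‖prox t φ v - v‖ ^ 2 / 2 := by field_simp
  rw [e] at h2
  have h3 : ‖prox t φ v - p‖ ^ 2 ≤ 0 := by linarith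
  have h4 : ‖prox t φ v - p‖ = 0 := by
    have := sq_nonneg ‖prox t φ v - p‖
    exact pow_eq_zero_iff two_ne_zero |>.1 (le_antisymm h3 this)
  exact sub_eq_zero.1 (norm_eq_zero.1 h4)

variable [CompleteSpace E]

theorem GammaZero.exists_isSubgrad_prox {φ : E → EReal} (hφ : GammaZero φ) {t : ℝ} (ht : 0 < t)
    (v : E) : ∃ a, IsSubgrad φ (prox t φ v) a (t⁻¹ • (v - prox t φ v)) := by
  suffices ∃ p a, IsSubgrad φ p a (t⁻¹ • (v - p)) by
    obtain ⟨p, a, h⟩ := this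
    exact ⟨a, by rwa [h.prox_eq ht]⟩
  have key : ∀ {z : E} {s : ℝ}, φ z ≤ s →
      ∀ ρ > 0, ∃ (x : E) (w : ℝ), ‖w‖ < ρ ∧
        φ x ≤ (((t * s + ‖z - v‖ ^ 2 / 2 - ‖x - v‖ ^ 2 / 2) / t : ℝ) : EReal) := by
    intro z s hz ρ hρ
    refine ⟨z, 0, by simpa using hρ, ?_⟩
    rw [add_sub_cancel_right, mul_div_cancel_left₀ _ ht.ne']
    exact hz
  obtain ⟨x₀, hx₀⟩ := hφ.proper
  -- The perturbation variable is a dummy: Φ does not depend on it.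
  obtain ⟨p, r, hp, hr⟩ := ConvLsc.exists_limit_minimizer (W := ℝ)
    (hφ.convLsc.comp (ContinuousLinearMap.fst ℝ E ℝ)) ht v
    (key (EReal.coe_toReal hx₀ (hφ.ne_bot x₀)).ge)
  obtain ⟨a, ha, har⟩ := exists_coe_of_le (hφ.ne_bot p) hp
  rw [le_div_iff₀ ht] at har
  refine ⟨p, a, ha, fun z s hz => ?_⟩
  have h0 : 0 ≤ t * (s - a) + inner ℝ (p - v) (z - p) := by
    refine nonneg_of_forall_mul_add_sq (B := ‖z - p‖ ^ 2 / 2) fun l hl0 hl1 => ?_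
    have h1 := hφ.convLsc.convex_le hz ha.le hl0.le (sub_nonneg.2 hl1) (by ring)
    have h2 := hr _ (key h1)
    have e : l • z + (1 - l) • p - p = l • (z - p) := by module
    rw [norm_sub_sq_expand p, e, inner_smul_right, norm_smul, mul_pow, Real.norm_of_nonneg hl0.le]
      at h2
    linarith
  rw [inner_smul_left, RCLike.conj_to_real, ← neg_sub p v, inner_neg_left]
  have : t⁻¹ * (t * (s - a) + inner ℝ (p - v) (z - p)) ≥ 0 := by positivity
  rw [mul_add, ← mul_assoc, inv_mul_cancel₀ ht.ne', one_mul] at this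
  linarith

theorem le_conj {E : Type*} [NormedAddCommGroup E] [InnerProductSpace ℝ E]
    {φ : E → EReal} {x : E} {r : ℝ} (h : φ x ≤ r) (y : E) :
    ((inner ℝ x y - r : ℝ) : EReal) ≤ conj φ y := by
  refine le_trans ?_ (le_iSup (fun x : E => ((inner ℝ x y : ℝ) : EReal) - φ x) x)
  rw [EReal.coe_sub]
  exact EReal.sub_le_sub le_rfl h

theorem IsSubgrad.conj_eq {E : Type*} [NormedAddCommGroup E] [InnerProductSpace ℝ E]
    {φ : E → EReal} (hφ : ∀ x, φ x ≠ ⊥) {x ξ : E} {a : ℝ}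
    (h : IsSubgrad φ x a ξ) : conj φ ξ = ((inner ℝ x ξ - a : ℝ) : EReal) := by
  refine le_antisymm (iSup_le fun z => ?_) (le_conj h.1.le ξ)
  by_cases hz : φ z = ⊤
  · simp [hz]
  · obtain ⟨b, hb⟩ : ∃ b : ℝ, φ z = b := ⟨_, (EReal.coe_toReal hz (hφ z)).symm⟩
    have := h.2 z b hb.le
    rw [hb, ← EReal.coe_sub, EReal.coe_le_coe_iff, real_inner_comm ξ z, real_inner_comm ξ x]
    rw [inner_sub_right] at this
    linarith

/-- Moreau decomposition: with q the proximal point of φ/t at w/t, the point w - tq satisfies the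
optimality condition for `conj φ`. Only the implication from ξ ∈ ∂φ(q) to q ∈ ∂φ*(ξ) is used, so no
biconjugate theorem enters. -/
theorem GammaZero.isSubgrad_prox_conj {φ : E → EReal} (hφ : GammaZero φ) {t : ℝ} (ht : 0 < t)
    (w : E) : ∃ a, IsSubgrad φ (t⁻¹ • (w - prox t (conj φ) w)) a (prox t (conj φ) w) := by
  obtain ⟨a, ha⟩ := hφ.exists_isSubgrad_prox (inv_pos.2 ht) (t⁻¹ • w)
  set q := prox t⁻¹ φ (t⁻¹ • w)
  have e : t⁻¹⁻¹ • (t⁻¹ • w - q) = w - t • q := by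
    rw [inv_inv, smul_sub, smul_smul, mul_inv_cancel₀ ht.ne', one_smul]
  rw [e] at ha
  have e2 : t⁻¹ • (w - (w - t • q)) = q := by
    rw [sub_sub_cancel, smul_smul, inv_mul_cancel₀ ht.ne', one_smul]
  have h2 : IsSubgrad (conj φ) (w - t • q) (inner ℝ q (w - t • q) - a)
      (t⁻¹ • (w - (w - t • q))) := by
    refine ⟨ha.conj_eq hφ.ne_bot, fun z r hz => ?_⟩
    rw [e2, inner_sub_right q z]
    have := (le_conj ha.1.le z).trans hz
    rw [EReal.coe_le_coe_iff] at this
    linarith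
  refine ⟨a, ?_⟩
  rw [h2.prox_eq ht, e2]
  exact ha

end PDFB
end

/-! ### The primal-dual step and ε-optimal dual points. -/

noncomputable section
namespace PDFB

section PrimalDual

variable {H Y : Type*} [NormedAddCommGroup H] [InnerProductSpace ℝ H] [CompleteSpace H]
  [NormedAddCommGroup Y] [InnerProductSpace ℝ Y] [CompleteSpace Y]

/-- The quadratic form of the metric in which the primal-dual iteration is a proximal point
method. -/
def pdForm (σ τ : ℝ) (K : H →L[ℝ] Y) (x : H) (y : Y) : ℝ :=
  τ⁻¹ * ‖x‖ ^ 2 - 2 * inner ℝ (K x) y + σ⁻¹ * ‖y‖ ^ 2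

/-- `y` is an `ε`-optimal dual point for `min_x ‖x - u‖² / 2 + γ (g(x) + F(K x))`, whose optimal
value is `P`. -/
def ApproxDual (γ : ℝ) (u : H) (g : H → EReal) (F : Y → EReal) (K : H →L[ℝ] Y) (P ε : ℝ)
    (y : Y) : Prop :=
  ∀ (z : H) (q : Y) (r s : ℝ), g z ≤ r → F q ≤ s →
    P - ε ≤ ‖z - u‖ ^ 2 / 2 + γ * r + inner ℝ (K z - q) y + γ * s

/-- The point of the dual space at which `y'` is a subgradient after a primal-dual step. -/
def pdPoint (σ : ℝ) (K : H →L[ℝ] Y) (x : H) (y : Y) (x' : H) (y' : Y) : Y :=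
  σ⁻¹ • (y - y') + K ((2 : ℝ) • x' - x)

/-- Optimality conditions for the primal-dual step from `(x, y)` to `(x', y')`. -/
structure PDStep (γ σ τ : ℝ) (u : H) (g : H → EReal) (F : Y → EReal) (K : H →L[ℝ] Y)
    (x : H) (y : Y) (x' : H) (y' : Y) : Prop where
  primal : ∃ a, IsSubgrad g x' a
    (γ⁻¹ • (τ⁻¹ • (x - x') - ContinuousLinearMap.adjoint K y + u - x'))
  dual : ∃ b, IsSubgrad F (pdPoint σ K x y x' y') b (γ⁻¹ • y')

/-- `p` solves `min_x ‖x - u‖² / 2 + γ (g(x) + F(K x))` with optimal value `P`. -/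
structure IsPrimalSol (γ : ℝ) (u : H) (g : H → EReal) (F : Y → EReal) (K : H →L[ℝ] Y)
    (p : H) (gp Fp P : ℝ) : Prop where
  g_eq : g p = gp
  F_eq : F (K p) = Fp
  value : P = ‖p - u‖ ^ 2 / 2 + γ * gp + γ * Fp
  min : ∀ (z : H) (r s : ℝ), g z ≤ r → F (K z) ≤ s → P ≤ ‖z - u‖ ^ 2 / 2 + γ * r + γ * s

variable {γ σ τ : ℝ} {u : H} {g : H → EReal} {F : Y → EReal} {K : H →L[ℝ] Y}

omit [CompleteSpace H] [CompleteSpace Y] in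
theorem exists_pdForm_lower_bound (hσ : 0 < σ) (hτ : 0 < τ) {b : ℝ} (hb : 0 ≤ b)
    (hK : ∀ x, ‖K x‖ ^ 2 ≤ b * ‖x‖ ^ 2) (hστ : σ * τ * b < 1) :
    ∃ c > 0, ∀ x y, c * (‖x‖ ^ 2 + ‖y‖ ^ 2) ≤ pdForm σ τ K x y := by
  set θ := σ * τ * b with hθ
  have hθ0 : 0 ≤ θ := by positivity
  -- By AM-GM √θ ≤ κ < 1, so Young's inequality with weights σ/κ and κ/σ bounds the cross term by
  -- the fraction κ of the two squares.
  set κ := (1 + θ) / 2 with hκ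
  have hκ0 : 0 < κ := by positivity
  have hκ1 : 0 < 1 - κ := by linarith
  have hκθ : θ ≤ κ ^ 2 := by nlinarith [sq_nonneg (1 - θ)]
  refine ⟨(1 - κ) * min τ⁻¹ σ⁻¹, by positivity, fun x y => ?_⟩
  have h1 : (inner ℝ (K x) y : ℝ) ≤ ‖K x‖ * ‖y‖ := real_inner_le_norm _ _
  have h2 : 2 * (‖K x‖ * ‖y‖) ≤ σ / κ * ‖K x‖ ^ 2 + κ / σ * ‖y‖ ^ 2 := by
    have e : σ / κ * ‖K x‖ ^ 2 + κ / σ * ‖y‖ ^ 2 - 2 * (‖K x‖ * ‖y‖)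
        = σ / κ * (‖K x‖ - κ / σ * ‖y‖) ^ 2 := by field_simp; ring
    have : 0 ≤ σ / κ * (‖K x‖ - κ / σ * ‖y‖) ^ 2 := by positivity
    linarith
  have h3 : σ / κ * ‖K x‖ ^ 2 ≤ κ * τ⁻¹ * ‖x‖ ^ 2 := by
    have e : σ / κ * b ≤ κ * τ⁻¹ := by
      rw [div_mul_eq_mul_div, div_le_iff₀ hκ0]
      have : σ * b = θ * τ⁻¹ := by rw [hθ]; field_simp
      rw [this]
      nlinarith [mul_le_mul_of_nonneg_right hκθ (inv_pos.2 hτ).le]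
    calc σ / κ * ‖K x‖ ^ 2 ≤ σ / κ * (b * ‖x‖ ^ 2) := by gcongr; exact hK x
      _ = σ / κ * b * ‖x‖ ^ 2 := by ring
      _ ≤ _ := by gcongr
  have h4 : κ / σ * ‖y‖ ^ 2 = κ * σ⁻¹ * ‖y‖ ^ 2 := by ring
  have h5 : min τ⁻¹ σ⁻¹ * ‖x‖ ^ 2 ≤ τ⁻¹ * ‖x‖ ^ 2 := by gcongr; exact min_le_left _ _
  have h6 : min τ⁻¹ σ⁻¹ * ‖y‖ ^ 2 ≤ σ⁻¹ * ‖y‖ ^ 2 := by gcongr; exact min_le_right _ _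
  have h7 := mul_le_mul_of_nonneg_left (add_le_add h5 h6) hκ1.le
  unfold pdForm
  linarith

/-- Three-point identity of the metric. The extrapolation 2x' - x gives `pdPoint` - K x' = σ⁻¹(y -
y') - K(x - x'), the dual component of the metric applied to the step; this makes the cross terms
symmetric. -/
theorem pdForm_step_identity (x x' p : H) (y y' ys : Y) :
    2 * (inner ℝ (τ⁻¹ • (x - x') - ContinuousLinearMap.adjoint K y) (p - x')
      + inner ℝ y' (K p - pdPoint σ K x y x' y')
      - inner ℝ (K x' - pdPoint σ K x y x' y') ys) =
    pdForm σ τ K (x' - p) (y' - ys) + pdForm σ τ K (x' - x) (y' - y)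
      - pdForm σ τ K (x - p) (y - ys) := by
  simp only [pdForm, pdPoint, ← real_inner_self_eq_norm_sq, map_sub, map_smul, inner_sub_left,
    inner_sub_right, inner_add_left, inner_add_right, inner_smul_left, inner_smul_right,
    RCLike.conj_to_real, ContinuousLinearMap.adjoint_inner_left]
  simp only [real_inner_comm x x', real_inner_comm p x', real_inner_comm p x,
    real_inner_comm y y', real_inner_comm ys y', real_inner_comm ys y,
    real_inner_comm (K x) y', real_inner_comm (K x') y', real_inner_comm (K p) y',
    real_inner_comm (K x') y, real_inner_comm (K p) y]
  ring

/-- Add the two subgradient inequalities, tested at p and K p, to the ε-optimality of `ys`, tested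
at x' and `pdPoint`. The term ‖x' - p‖² comes from the quadratic, the loss 2ε from inexact duality.
-/
theorem PDStep.fejer (hγ : 0 < γ) {p : H} {gp Fp P ε : ℝ}
    (hp : IsPrimalSol γ u g F K p gp Fp P) {ys : Y} (hys : ApproxDual γ u g F K P ε ys)
    {x x' : H} {y y' : Y} (hs : PDStep γ σ τ u g F K x y x' y') :
    pdForm σ τ K (x' - p) (y' - ys) + pdForm σ τ K (x' - x) (y' - y) + ‖x' - p‖ ^ 2
      ≤ pdForm σ τ K (x - p) (y - ys) + 2 * ε := by
  obtain ⟨⟨a, ha⟩, b, hb⟩ := hs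
  have h1 := mul_le_mul_of_nonneg_left (ha.2 p gp hp.g_eq.le) hγ.le
  have h2 := mul_le_mul_of_nonneg_left (hb.2 (K p) Fp hp.F_eq.le) hγ.le
  have h3 := hys _ _ _ _ ha.1.le hb.1.le
  have h4 := hp.value
  have h5 := norm_sub_sq_expand x' p u
  have h6 := pdForm_step_identity (K := K) (σ := σ) (τ := τ) x x' p y y' ys
  rw [inner_smul_left, RCLike.conj_to_real, mul_add, ← mul_assoc, mul_inv_cancel₀ hγ.ne',
    one_mul] at h1 h2
  rw [add_sub_assoc, ← neg_sub x' u, ← sub_eq_add_neg, inner_sub_left] at h1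
  rw [norm_sub_rev p x'] at h5
  linarith

/-- Minimality of the Lagrangian in the primal variable, up to the residual of the step. -/
theorem PDStep.lagrangian_le (hγ : 0 < γ) {x x' : H} {y y' : Y} {a : ℝ}
    (ha : IsSubgrad g x' a
      (γ⁻¹ • (τ⁻¹ • (x - x') - ContinuousLinearMap.adjoint K y + u - x')))
    {z : H} {r : ℝ} (hz : g z ≤ r) :
    ‖x' - u‖ ^ 2 / 2 + γ * a + inner ℝ (K x') y'
      - ‖τ⁻¹ • (x - x') - ContinuousLinearMap.adjoint K (y - y')‖ ^ 2 / 2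
      ≤ ‖z - u‖ ^ 2 / 2 + γ * r + inner ℝ (K z) y' := by
  have h1 := mul_le_mul_of_nonneg_left (ha.2 z r hz) hγ.le
  rw [inner_smul_left, RCLike.conj_to_real, mul_add, ← mul_assoc, mul_inv_cancel₀ hγ.ne',
    one_mul, add_sub_assoc, ← neg_sub x' u, ← sub_eq_add_neg, inner_sub_left] at h1
  have h5 := norm_sub_sq_expand x' z u
  have h6 : (inner ℝ (K z) y' : ℝ) = inner ℝ (K x') y' +
      inner ℝ (ContinuousLinearMap.adjoint K y') (z - x') := by
    rw [ContinuousLinearMap.adjoint_inner_left, map_sub, inner_sub_right, real_inner_comm,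
      real_inner_comm (K x')]
    ring
  set ρ := τ⁻¹ • (x - x') - ContinuousLinearMap.adjoint K (y - y') with hρ
  have h7 : (inner ℝ (τ⁻¹ • (x - x') - ContinuousLinearMap.adjoint K y) (z - x') : ℝ)
      = inner ℝ ρ (z - x') - inner ℝ (ContinuousLinearMap.adjoint K y') (z - x') := by
    rw [← inner_sub_left, hρ, map_sub]
    congr 1
    abel
  have h8 : 0 ≤ ‖ρ‖ ^ 2 + 2 * inner ℝ ρ (z - x') + ‖z - x'‖ ^ 2 := by
    rw [← norm_add_sq_real]; positivity
  linarith

/-- Duality without constraint qualification. `C` consists of the pairs (w, r) such that r is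
attained as an upper bound in the problem perturbed by w. By `exists_limit_minimizer` the point (0,
P - ε) is not in its closure, and the slope of a separating hyperplane is the dual point. -/
theorem exists_approxDual (hγ : 0 < γ) (hg : ConvLsc g) (hF : ConvLsc F) {p : H} {gp Fp P : ℝ}
    (hp : IsPrimalSol γ u g F K p gp Fp P) {ε : ℝ} (hε : 0 < ε) :
    ∃ y, ApproxDual γ u g F K P ε y := by
  set Φ : H × Y → EReal := fun v => g v.1 + F (K v.1 - v.2) with hΦdef
  have hΦ : ConvLsc Φ :=
    (hg.comp (ContinuousLinearMap.fst ℝ H Y)).add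
      (hF.comp (K.comp (ContinuousLinearMap.fst ℝ H Y) - ContinuousLinearMap.snd ℝ H Y))
  set C : Set (Y × ℝ) :=
    {v | ∃ x, Φ (x, v.1) ≤ (((v.2 - ‖x - u‖ ^ 2 / 2) / γ : ℝ) : EReal)} with hC
  have hCmem : ∀ {z : H} {q : Y} {r s : ℝ}, g z ≤ r → F q ≤ s →
      (K z - q, ‖z - u‖ ^ 2 / 2 + γ * r + γ * s) ∈ C := by
    intro z q r s hr hs
    refine ⟨z, ?_⟩
    have e : (‖z - u‖ ^ 2 / 2 + γ * r + γ * s - ‖z - u‖ ^ 2 / 2) / γ = r + s := by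
      field_simp; ring
    simp only [e, hΦdef, sub_sub_cancel, EReal.coe_add]
    exact add_le_add hr hs
  have hconv : Convex ℝ C := by
    rintro ⟨w, r⟩ ⟨x, hx⟩ ⟨w', r'⟩ ⟨x', hx'⟩ a b ha hb hab
    refine ⟨a • x + b • x', (hΦ.convex_le hx hx' ha hb hab).trans ?_⟩
    rw [EReal.coe_le_coe_iff]
    have e : a * ((r - ‖x - u‖ ^ 2 / 2) / γ) + b * ((r' - ‖x' - u‖ ^ 2 / 2) / γ)
      = (a * r + b * r' - (a * ‖x - u‖ ^ 2 + b * ‖x' - u‖ ^ 2) / 2) / γ := by ring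
    have h1 : ‖a • x + b • x' - u‖ ^ 2 ≤ a * ‖x - u‖ ^ 2 + b * ‖x' - u‖ ^ 2 := by
      have e1 : a • x + b • x' - u = a • (x - u) + b • (x' - u) := by
        obtain rfl : b = 1 - a := by linarith
        module
      have h2 := norm_add_le (a • (x - u)) (b • (x' - u))
      rw [norm_smul, norm_smul, Real.norm_of_nonneg ha, Real.norm_of_nonneg hb] at h2
      rw [e1]
      have h3 := pow_le_pow_left₀ (norm_nonneg _) h2 2
      have h4 : a * ‖x - u‖ ^ 2 + b * ‖x' - u‖ ^ 2 - (a * ‖x - u‖ + b * ‖x' - u‖) ^ 2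
        = a * b * (‖x - u‖ - ‖x' - u‖) ^ 2 := by
        obtain rfl : b = 1 - a := by linarith
        ring
      have : 0 ≤ a * b * (‖x - u‖ - ‖x' - u‖) ^ 2 := by positivity
      linarith
    simp only [Prod.smul_mk, Prod.mk_add_mk, smul_eq_mul]
    rw [e]
    gcongr
  have hnot : ((0 : Y), P - ε) ∉ closure C := by
    intro hmem
    have hcl : ∀ ρ > 0, ∃ x w, ‖w‖ < ρ ∧
        Φ (x, w) ≤ (((P - ε / 2 - ‖x - u‖ ^ 2 / 2) / γ : ℝ) : EReal) := by
      intro ρ hρ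
      obtain ⟨⟨w, r⟩, ⟨x, hx⟩, hd⟩ := Metric.mem_closure_iff.1 hmem (min ρ (ε / 2)) (by positivity)
      rw [Prod.dist_eq, max_lt_iff, lt_min_iff, lt_min_iff] at hd
      obtain ⟨⟨hd1, -⟩, -, hd2⟩ := hd
      refine ⟨x, w, by simpa [dist_eq_norm] using hd1, hx.trans ?_⟩
      rw [EReal.coe_le_coe_iff]
      rw [Real.dist_eq, abs_lt] at hd2
      dsimp only at hd2 ⊢
      gcongr
      linarith
    obtain ⟨x, r, hx, hr⟩ := hΦ.exists_limit_minimizer hγ u hcl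
    have hr2 : r ≤ P - ε / 2 := hr _ hcl
    simp only [hΦdef, sub_zero] at hx
    obtain ⟨a, b, ha, hb, hab⟩ := exists_coe_of_add_le (hg.ne_bot _) (hF.ne_bot _) hx
    have h1 := hp.min x a b ha.le hb.le
    rw [le_div_iff₀ hγ] at hab
    linarith
  obtain ⟨f, c, hf0, hf⟩ := geometric_hahn_banach_point_closed hconv.closure isClosed_closure hnot
  set α : ℝ := f (0, 1) with hα
  set l : Y →L[ℝ] ℝ := f.comp (ContinuousLinearMap.inl ℝ Y ℝ) with hl
  have hsplit : ∀ (w : Y) (r : ℝ), f (w, r) = l w + r * α := by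
    intro w r
    rw [hl, hα, ← smul_eq_mul, ← map_smul, ContinuousLinearMap.comp_apply,
      ContinuousLinearMap.inl_apply, ← map_add]
    simp
  have hlt : ∀ {z : H} {q : Y} {r s : ℝ}, g z ≤ r → F q ≤ s →
      (P - ε) * α < l (K z - q) + (‖z - u‖ ^ 2 / 2 + γ * r + γ * s) * α := by
    intro z q r s hr hs
    have := hf0.trans (hf _ (subset_closure (hCmem hr hs)))
    rwa [hsplit, hsplit, map_zero, zero_add] at this
  have hαpos : 0 < α := by
    have := hlt hp.g_eq.le hp.F_eq.le
    rw [sub_self, map_zero, zero_add, ← hp.value] at this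
    by_contra! hle
    nlinarith
  refine ⟨α⁻¹ • (InnerProductSpace.toDual ℝ Y).symm l, fun z q r s hr hs => ?_⟩
  rw [inner_smul_right, real_inner_comm, InnerProductSpace.toDual_symm_apply]
  have h1 := hlt hr hs
  have h2 : α⁻¹ * ((P - ε) * α) < α⁻¹ * (l (K z - q) +
    (‖z - u‖ ^ 2 / 2 + γ * r + γ * s) * α) := by gcongr
  have e1 : α⁻¹ * ((P - ε) * α) = P - ε := by field_simp
  have e2 : α⁻¹ * (l (K z - q) + (‖z - u‖ ^ 2 / 2 + γ * r + γ * s) * α) =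
    α⁻¹ * l (K z - q) + (‖z - u‖ ^ 2 / 2 + γ * r + γ * s) := by field_simp
  linarith

end PrimalDual
end PDFB
end

/-! ### Convergence of the abstract primal-dual iteration. -/

noncomputable section
namespace PDFB

theorem tendsto_zero_of_norm_sq_le {V : Type*} [NormedAddCommGroup V] {v : ℕ → V} {a : ℕ → ℝ}
    (hv : ∀ n, ‖v n‖ ^ 2 ≤ a n) (ha : Tendsto a atTop (𝓝 0)) : Tendsto v atTop (𝓝 0) := by
  rw [tendsto_zero_iff_norm_tendsto_zero]
  have h0 : Tendsto (fun n => ‖v n‖ ^ 2) atTop (𝓝 0) :=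
    squeeze_zero (fun n => sq_nonneg _) hv ha
  simpa [Real.sqrt_sq] using h0.sqrt

section PrimalDualIteration

variable {H Y : Type*} [NormedAddCommGroup H] [InnerProductSpace ℝ H] [CompleteSpace H]
  [NormedAddCommGroup Y] [InnerProductSpace ℝ Y] [CompleteSpace Y]
  {γ σ τ : ℝ} {u : H} {g : H → EReal} {F : Y → EReal} {K : H →L[ℝ] Y}
  {p : H} {gp Fp P ε c : ℝ} {x : ℕ → H} {y : ℕ → Y}

theorem sum_pdForm_le (hγ : 0 < γ) (hp : IsPrimalSol γ u g F K p gp Fp P) {ys : Y}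
    (hys : ApproxDual γ u g F K P ε ys)
    (hs : ∀ j, PDStep γ σ τ u g F K (x j) (y j) (x (j + 1)) (y (j + 1))) (n : ℕ) :
    pdForm σ τ K (x n - p) (y n - ys) + ∑ j ∈ Finset.range n,
        (pdForm σ τ K (x (j + 1) - x j) (y (j + 1) - y j) + ‖x (j + 1) - p‖ ^ 2)
      ≤ pdForm σ τ K (x 0 - p) (y 0 - ys) + n * (2 * ε) := by
  induction n with
  | zero => simp
  | succ n ih =>
    have := (hs n).fejer hγ hp hys
    rw [Finset.sum_range_succ]
    push_cast
    linarith

variable (hc : 0 < c) (hform : ∀ x y, c * (‖x‖ ^ 2 + ‖y‖ ^ 2) ≤ pdForm σ τ K x y)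
include hc hform

omit [CompleteSpace H] [CompleteSpace Y] in
theorem pdForm_nonneg (x : H) (y : Y) : 0 ≤ pdForm σ τ K x y :=
  le_trans (by positivity) (hform x y)

theorem exists_norm_sub_sq_lt (hγ : 0 < γ) (hp : IsPrimalSol γ u g F K p gp Fp P)
    (hdual : ∀ ε > 0, ∃ ys, ApproxDual γ u g F K P ε ys)
    (hs : ∀ j, PDStep γ σ τ u g F K (x j) (y j) (x (j + 1)) (y (j + 1))) {δ : ℝ} (hδ : 0 < δ) :
    ∃ j, ‖x (j + 1) - p‖ ^ 2 < δ := by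
  by_contra! hge
  -- ε is fixed before the number of steps, so the size of `ys` is harmless. If every squared
  -- distance were at least δ, each step would decrease the metric distance by δ - 2ε = δ/2, which
  -- cannot go on.
  obtain ⟨ys, hys⟩ := hdual (δ / 4) (by positivity)
  obtain ⟨n, hn⟩ := exists_nat_gt (pdForm σ τ K (x 0 - p) (y 0 - ys) / (δ / 2))
  rw [div_lt_iff₀ (by positivity)] at hn
  have h1 := sum_pdForm_le hγ hp hys hs n
  have h2 : ∑ _j ∈ Finset.range n, δ ≤ ∑ j ∈ Finset.range n,
      (pdForm σ τ K (x (j + 1) - x j) (y (j + 1) - y j) + ‖x (j + 1) - p‖ ^ 2) :=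
    Finset.sum_le_sum fun j _ =>
      (hge j).trans (le_add_of_nonneg_left (pdForm_nonneg hc hform _ _))
  rw [Finset.sum_const, Finset.card_range, nsmul_eq_mul] at h2
  have := pdForm_nonneg hc hform (x n - p) (y n - ys)
  linarith

theorem tendsto_of_exact_dual (hγ : 0 < γ) (hp : IsPrimalSol γ u g F K p gp Fp P) {ys : Y}
    (hys : ApproxDual γ u g F K P 0 ys)
    (hs : ∀ j, PDStep γ σ τ u g F K (x j) (y j) (x (j + 1)) (y (j + 1))) :
    Tendsto x atTop (𝓝 p) := by
  have hsum : Summable fun j => ‖x (j + 1) - p‖ ^ 2 := by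
    refine summable_of_sum_range_le (c := pdForm σ τ K (x 0 - p) (y 0 - ys))
      (fun _ => by positivity) fun n => ?_
    have h1 := sum_pdForm_le hγ hp hys hs n
    have h2 := pdForm_nonneg hc hform (x n - p) (y n - ys)
    rw [Finset.sum_add_distrib] at h1
    have h3 : 0 ≤ ∑ j ∈ Finset.range n, pdForm σ τ K (x (j + 1) - x j) (y (j + 1) - y j) :=
      Finset.sum_nonneg fun j _ => pdForm_nonneg hc hform _ _
    linarith
  rw [← tendsto_add_atTop_iff_nat 1, ← tendsto_sub_nhds_zero_iff]
  exact tendsto_zero_of_norm_sq_le (fun _ => le_rfl) hsum.tendsto_atTop_zero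

/-- With dual points bounded by `R`, the initial metric distance is at most some `A` for all ε.
Hence ε may depend on the number n of steps, and one index among them has all increments small while
the dual iterate stays in a fixed ball. -/
theorem exists_small_step {R : ℝ} (hγ : 0 < γ) (hp : IsPrimalSol γ u g F K p gp Fp P)
    (hdual : ∀ ε, 0 < ε → ε ≤ 1 → ∃ ys, ‖ys‖ ≤ R ∧ ApproxDual γ u g F K P ε ys)
    (hs : ∀ j, PDStep γ σ τ u g F K (x j) (y j) (x (j + 1)) (y (j + 1))) :
    ∃ C, ∀ η > 0, ∃ j, ‖x (j + 1) - p‖ ^ 2 < η ∧ ‖x (j + 1) - x j‖ ^ 2 < η ∧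
      ‖y (j + 1) - y j‖ ^ 2 < η ∧ ‖y (j + 1)‖ ≤ C := by
  have hA : ∃ A, ∀ ys, ‖ys‖ ≤ R → pdForm σ τ K (x 0 - p) (y 0 - ys) ≤ A := by
    refine ⟨τ⁻¹ * ‖x 0 - p‖ ^ 2 + 2 * (‖K (x 0 - p)‖ * (‖y 0‖ + R))
      + |σ⁻¹| * (‖y 0‖ + R) ^ 2, fun ys hR => ?_⟩
    have h1 : ‖y 0 - ys‖ ≤ ‖y 0‖ + R := (norm_sub_le _ _).trans (by linarith)
    have h2 : -(‖K (x 0 - p)‖ * (‖y 0‖ + R)) ≤ inner ℝ (K (x 0 - p)) (y 0 - ys) :=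
      (neg_le_neg (by gcongr)).trans (neg_le_of_abs_le (abs_real_inner_le_norm _ _))
    have h3 : σ⁻¹ * ‖y 0 - ys‖ ^ 2 ≤ |σ⁻¹| * (‖y 0‖ + R) ^ 2 :=
      (mul_le_mul_of_nonneg_right (le_abs_self _) (by positivity)).trans (by gcongr)
    unfold pdForm
    linarith
  obtain ⟨A, hA⟩ := hA
  have hA0 : 0 ≤ A := by
    obtain ⟨ys, hR, -⟩ := hdual 1 one_pos le_rfl
    exact (pdForm_nonneg hc hform _ _).trans (hA ys hR)
  refine ⟨R + √((A + 2) / c), fun η hη => ?_⟩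
  obtain ⟨n, hn⟩ := exists_nat_gt ((A + 2) / (min 1 c * η))
  rw [div_lt_iff₀ (by positivity)] at hn
  have hnpos : 0 < (n : ℝ) := by
    by_contra! hle
    have : (n : ℝ) * (min 1 c * η) ≤ 0 := mul_nonpos_of_nonpos_of_nonneg hle (by positivity)
    linarith
  have hn1 : (1 : ℝ) ≤ n := by exact_mod_cast (show 0 < n by exact_mod_cast hnpos)
  -- Over n steps the errors 2ε add up to at most 2, whence `A + 2` below.
  obtain ⟨ys, hR, hys⟩ := hdual (1 / n) (by positivity) (by rw [div_le_one hnpos]; exact hn1)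
  have hbound : ∀ k ≤ n, pdForm σ τ K (x k - p) (y k - ys) + ∑ j ∈ Finset.range k,
      (pdForm σ τ K (x (j + 1) - x j) (y (j + 1) - y j) + ‖x (j + 1) - p‖ ^ 2) ≤ A + 2 := by
    intro k hk
    refine (sum_pdForm_le hγ hp hys hs k).trans ?_
    have h1 : (k : ℝ) * (2 * (1 / n)) ≤ 2 := by
      have : (k : ℝ) ≤ n := by exact_mod_cast hk
      rw [mul_one_div, ← mul_div_assoc, div_le_iff₀ hnpos]
      linarith
    linarith [hA ys hR]
  have hterm : ∃ j < n, pdForm σ τ K (x (j + 1) - x j) (y (j + 1) - y j) + ‖x (j + 1) - p‖ ^ 2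
      < min 1 c * η := by
    by_contra! hge
    have h2 : ∑ _j ∈ Finset.range n, min 1 c * η ≤ ∑ j ∈ Finset.range n,
      (pdForm σ τ K (x (j + 1) - x j) (y (j + 1) - y j) + ‖x (j + 1) - p‖ ^ 2) :=
      Finset.sum_le_sum fun j hj => hge j (Finset.mem_range.1 hj)
    rw [Finset.sum_const, Finset.card_range, nsmul_eq_mul] at h2
    have := hbound n le_rfl
    have := pdForm_nonneg hc hform (x n - p) (y n - ys)
    linarith
  obtain ⟨j, hj, hlt⟩ := hterm
  have hm1 : min 1 c * η ≤ η := mul_le_of_le_one_left hη.le (min_le_left _ _)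
  have hm2 : min 1 c * η ≤ c * η := by gcongr; exact min_le_right _ _
  have hf := hform (x (j + 1) - x j) (y (j + 1) - y j)
  have hx2 := sq_nonneg ‖x (j + 1) - p‖
  have hsum : ‖x (j + 1) - x j‖ ^ 2 + ‖y (j + 1) - y j‖ ^ 2 < η := by
    by_contra! hle
    have := mul_le_mul_of_nonneg_left hle hc.le
    linarith
  refine ⟨j, ?_, ?_, ?_, ?_⟩
  · have := pdForm_nonneg hc hform (x (j + 1) - x j) (y (j + 1) - y j)
    linarith
  · linarith [sq_nonneg ‖y (j + 1) - y j‖]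
  · linarith [sq_nonneg ‖x (j + 1) - x j‖]
  · have h1 := hbound (j + 1) hj
    have h2 : 0 ≤ ∑ i ∈ Finset.range (j + 1),
        (pdForm σ τ K (x (i + 1) - x i) (y (i + 1) - y i) + ‖x (i + 1) - p‖ ^ 2) :=
      Finset.sum_nonneg fun i _ => add_nonneg (pdForm_nonneg hc hform _ _) (sq_nonneg _)
    have h3 := hform (x (j + 1) - p) (y (j + 1) - ys)
    have h4 : ‖y (j + 1) - ys‖ ^ 2 ≤ (A + 2) / c := by
      rw [le_div_iff₀ hc]
      nlinarith [sq_nonneg ‖x (j + 1) - p‖]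
    have h5 := Real.le_sqrt_of_sq_le h4
    have h6 : ‖y (j + 1)‖ ≤ ‖ys‖ + ‖y (j + 1) - ys‖ := norm_le_norm_add_norm_sub' _ _
    linarith

omit hc hform [CompleteSpace H] [CompleteSpace Y] in
theorem ApproxDual.norm_le {F : Y → EReal} (hp : IsPrimalSol γ u g F K p gp Fp P)
    {ys : Y} (hys : ApproxDual γ u g F K P ε ys) {ρ M : ℝ} (hρ : 0 < ρ)
    (hM : ∀ q, ‖q - K p‖ ≤ ρ → F q ≤ (M : EReal)) :
    ‖ys‖ ≤ (γ * (M - Fp) + ε) / ρ := by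
  rw [le_div_iff₀ hρ]
  -- Move from K p by ρ in the direction of `ys`; for `ys = 0` division by zero leaves the point K
  -- p.
  have key := hys p (K p + (ρ / ‖ys‖) • ys) gp M hp.g_eq.le (hM _ (by
    rw [add_sub_cancel_left, norm_smul, norm_div, norm_norm, Real.norm_of_nonneg hρ.le]
    rcases eq_or_ne ‖ys‖ 0 with h0 | h0
    · simpa [h0] using hρ.le
    · exact (div_mul_cancel₀ ρ h0).le))
  rw [sub_add_cancel_left, inner_neg_left, inner_smul_left, RCLike.conj_to_real,
    real_inner_self_eq_norm_sq, hp.value] at key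
  have e : ρ / ‖ys‖ * ‖ys‖ ^ 2 = ‖ys‖ * ρ := by
    by_cases h0 : ‖ys‖ = 0
    · simp [h0]
    · field_simp
  rw [e] at key
  linarith

/-- The expression estimated is the bound for the gap in `gap_innerStep_le`. Continuity at K p
bounds the ε-optimal dual points; along the indices of `exists_small_step` both K x and `pdPoint`
tend to K p, and bounded dual iterates make the inner product vanish. -/
theorem exists_small_gap_bound {Fr : Y → ℝ} (hFr : Continuous Fr) (hγ : 0 < γ)
    (hg : ConvLsc g) (hF : ConvLsc (fun q => (Fr q : EReal)))
    (hp : IsPrimalSol γ u g (fun q => (Fr q : EReal)) K p gp Fp P)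
    (hs : ∀ j, PDStep γ σ τ u g (fun q => (Fr q : EReal)) K (x j) (y j) (x (j + 1)) (y (j + 1)))
    {δ : ℝ} (hδ : 0 < δ) :
    ∃ j, γ * (Fr (K (x (j + 1))) - Fr (pdPoint σ K (x j) (y j) (x (j + 1)) (y (j + 1))))
      + inner ℝ (pdPoint σ K (x j) (y j) (x (j + 1)) (y (j + 1)) - K (x (j + 1))) (y (j + 1))
      + ‖τ⁻¹ • (x j - x (j + 1)) - ContinuousLinearMap.adjoint K (y j - y (j + 1))‖ ^ 2 / 2
      < δ := by
  have hR : ∃ R, ∀ ε, 0 < ε → ε ≤ 1 →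
      ∃ ys, ‖ys‖ ≤ R ∧ ApproxDual γ u g (fun q => (Fr q : EReal)) K P ε ys := by
    obtain ⟨ρ, hρ, hball⟩ := Metric.continuousAt_iff.1 (hFr.continuousAt (x := K p)) 1 one_pos
    refine ⟨(γ * (Fr (K p) + 1 - Fp) + 1) / (ρ / 2), fun ε hε hε1 => ?_⟩
    obtain ⟨ys, hys⟩ := exists_approxDual hγ hg hF hp hε
    refine ⟨ys, (hys.norm_le (M := Fr (K p) + 1) hp (half_pos hρ) fun q hq => ?_).trans
      (by gcongr), hys⟩
    have h1 := hball (x := q) (by rw [dist_eq_norm]; linarith)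
    rw [Real.dist_eq, abs_lt] at h1
    exact EReal.coe_le_coe_iff.2 (by linarith)
  obtain ⟨R, hR⟩ := hR
  obtain ⟨C, hC⟩ := exists_small_step hc hform hγ hp hR hs
  choose j hj1 hj2 hj3 hj4 using fun n : ℕ => hC (1 / ((n : ℝ) + 1)) Nat.one_div_pos_of_nat
  have hlim : Tendsto (fun n : ℕ => 1 / ((n : ℝ) + 1)) atTop (𝓝 0) :=
    tendsto_one_div_add_atTop_nhds_zero_nat
  have hx1 := tendsto_zero_of_norm_sq_le (fun n => (hj1 n).le) hlim
  have hx2 := tendsto_zero_of_norm_sq_le (fun n => (hj2 n).le) hlim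
  have hy3 := tendsto_zero_of_norm_sq_le (fun n => (hj3 n).le) hlim
  have hx4 : Tendsto (fun n => x (j n + 1)) atTop (𝓝 p) := by
    simpa using hx1.add_const p
  have hKx : Tendsto (fun n => K (x (j n + 1))) atTop (𝓝 (K p)) := (K.continuous.tendsto p).comp hx4
  set q : ℕ → Y := fun n => pdPoint σ K (x (j n)) (y (j n)) (x (j n + 1)) (y (j n + 1)) with hq
  have hqK : Tendsto (fun n => q n - K (x (j n + 1))) atTop (𝓝 0) := by
    have e : ∀ n, q n - K (x (j n + 1)) = K (x (j n + 1) - x (j n))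
        - σ⁻¹ • (y (j n + 1) - y (j n)) := by
      intro n
      simp only [hq, pdPoint, map_sub, map_smul]
      module
    simp only [e]
    simpa using ((K.continuous.tendsto 0).comp hx2).sub (hy3.const_smul σ⁻¹)
  have hqp : Tendsto q atTop (𝓝 (K p)) := by simpa using hqK.add hKx
  have hin : Tendsto (fun n => (inner ℝ (q n - K (x (j n + 1))) (y (j n + 1)) : ℝ))
      atTop (𝓝 0) := by
    refine squeeze_zero_norm (a := fun n => ‖q n - K (x (j n + 1))‖ * C) (fun n => ?_)
      (by simpa using hqK.norm.mul_const C)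
    exact (norm_inner_le_norm _ _).trans (by gcongr; exact hj4 n)
  have hres : Tendsto (fun n => ‖τ⁻¹ • (x (j n) - x (j n + 1))
      - ContinuousLinearMap.adjoint K (y (j n) - y (j n + 1))‖ ^ 2 / 2) atTop (𝓝 0) := by
    have e : ∀ n, τ⁻¹ • (x (j n) - x (j n + 1))
      - ContinuousLinearMap.adjoint K (y (j n) - y (j n + 1)) =
        ContinuousLinearMap.adjoint K (y (j n + 1) - y (j n)) - τ⁻¹ • (x (j n + 1) - x (j n)) := by
      intro n
      simp only [map_sub]
      module
    simp only [e]
    have := (((ContinuousLinearMap.adjoint K).continuous.tendsto 0).comp hy3).sub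
      (hx2.const_smul τ⁻¹)
    simpa using (this.norm.pow 2).div_const 2
  have hFF : Tendsto (fun n => γ * (Fr (K (x (j n + 1))) - Fr (q n))) atTop (𝓝 0) := by
    simpa using (((hFr.tendsto _).comp hKx).sub ((hFr.tendsto _).comp hqp)).const_mul γ
  have htot := (hFF.add hin).add hres
  simp only [add_zero] at htot
  obtain ⟨n, hn⟩ := (htot.eventually (gt_mem_nhds hδ)).exists
  exact ⟨j n, hn⟩

end PrimalDualIteration
end PDFB
end

noncomputable section
namespace PDFB

/-! ### Convex functions with Lipschitz gradient. -/

section Smooth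

variable {H : Type*} [NormedAddCommGroup H] [InnerProductSpace ℝ H] [CompleteSpace H] {f : H → ℝ}

theorem hasDerivAt_comp_line (hf : Differentiable ℝ f) (x d : H) (t : ℝ) :
    HasDerivAt (fun s : ℝ => f (x + s • d)) (inner ℝ (gradient f (x + t • d)) d) t := by
  have h1 := (hf (x + t • d)).hasGradientAt.hasFDerivAt
  have h2 : HasDerivAt (fun s : ℝ => x + s • d) d t := by
    simpa using ((hasDerivAt_id t).smul_const d).const_add x
  exact h1.comp_hasDerivAt t h2

theorem tendsto_slope_line (hf : Differentiable ℝ f) (x d : H) :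
    Tendsto (fun t : ℝ => t⁻¹ * (f (x + t • d) - f x)) (𝓝[>] 0)
      (𝓝 (inner ℝ (gradient f x) d)) := by
  simpa using (hasDerivAt_comp_line hf x d 0).tendsto_slope_zero_right

theorem le_inner_gradient (hf : Differentiable ℝ f) {x d : H} {c : ℝ}
    (h : ∀ t : ℝ, 0 < t → t ≤ 1 → t * c ≤ f (x + t • d) - f x) :
    c ≤ inner ℝ (gradient f x) d := by
  refine ge_of_tendsto (tendsto_slope_line hf x d) ?_
  filter_upwards [Ioc_mem_nhdsGT (zero_lt_one' ℝ)] with t ht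
  rw [inv_mul_eq_div, le_div_iff₀ ht.1, mul_comm]
  exact h t ht.1 ht.2

theorem inner_gradient_le (hf : Differentiable ℝ f) {x d : H} {c : ℝ}
    (h : ∀ t : ℝ, 0 < t → t ≤ 1 → f (x + t • d) - f x ≤ t * c) :
    inner ℝ (gradient f x) d ≤ c := by
  refine le_of_tendsto (tendsto_slope_line hf x d) ?_
  filter_upwards [Ioc_mem_nhdsGT (zero_lt_one' ℝ)] with t ht
  rw [inv_mul_eq_div, div_le_iff₀ ht.1, mul_comm]
  exact h t ht.1 ht.2

theorem add_inner_gradient_le (hc : ConvexOn ℝ Set.univ f) (hf : Differentiable ℝ f) (x z : H) :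
    f x + inner ℝ (gradient f x) (z - x) ≤ f z := by
  have : inner ℝ (gradient f x) (z - x) ≤ f z - f x := by
    refine inner_gradient_le hf fun t ht0 ht1 => ?_
    have h := hc.2 (Set.mem_univ x) (Set.mem_univ z) (sub_nonneg.2 ht1) ht0.le (by ring)
    rw [show (1 - t) • x + t • z = x + t • (z - x) by module, smul_eq_mul, smul_eq_mul] at h
    linarith
  linarith

theorem le_quadratic_upper_bound (hf : Differentiable ℝ f) {L : ℝ}
    (hL : ∀ x z, ‖gradient f x - gradient f z‖ ≤ L * ‖x - z‖) (x z : H) :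
    f z ≤ f x + inner ℝ (gradient f x) (z - x) + L / 2 * ‖z - x‖ ^ 2 := by
  set d := z - x with hd
  have hder : ∀ t : ℝ, HasDerivAt
      (fun s : ℝ => f (x + s • d) - s * inner ℝ (gradient f x) d - s ^ 2 * (L / 2 * ‖d‖ ^ 2))
      (inner ℝ (gradient f (x + t • d)) d - inner ℝ (gradient f x) d - t * (L * ‖d‖ ^ 2)) t := by
    intro t
    have h1 := ((hasDerivAt_comp_line hf x d t).sub
      ((hasDerivAt_id t).mul_const (inner ℝ (gradient f x) d))).sub
      ((hasDerivAt_pow 2 t).mul_const (L / 2 * ‖d‖ ^ 2))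
    refine h1.congr_deriv ?_
    norm_num
    ring
  have hanti := antitoneOn_of_deriv_nonpos (convex_Icc (0 : ℝ) 1)
    (fun t _ => (hder t).continuousAt.continuousWithinAt)
    (fun t _ => (hder t).differentiableAt.differentiableWithinAt) (fun t ht => by
      rw [interior_Icc] at ht
      rw [(hder t).deriv, ← inner_sub_left]
      have h1 := real_inner_le_norm (gradient f (x + t • d) - gradient f x) d
      have h2 := hL (x + t • d) x
      rw [add_sub_cancel_left, norm_smul, Real.norm_of_nonneg ht.1.le] at h2
      have h3 := mul_le_mul_of_nonneg_right h2 (norm_nonneg d)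
      linarith)
  have := hanti (Set.left_mem_Icc.2 zero_le_one) (Set.right_mem_Icc.2 zero_le_one) zero_le_one
  simp only [one_smul, zero_smul, add_zero, hd, add_sub_cancel] at this
  rw [← hd] at this
  linarith

/-- The Baillon–Haddad theorem: the gradient of a convex function is cocoercive as soon as it is
Lipschitz continuous. -/
theorem norm_gradient_sub_sq_le (hc : ConvexOn ℝ Set.univ f) (hf : Differentiable ℝ f) {L : ℝ}
    (hL0 : 0 < L) (hL : ∀ x z, ‖gradient f x - gradient f z‖ ≤ L * ‖x - z‖) (x z : H) :
    L⁻¹ * ‖gradient f x - gradient f z‖ ^ 2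
      ≤ inner ℝ (gradient f x - gradient f z) (x - z) := by
  have key : ∀ x z : H, f x + inner ℝ (gradient f x) (z - x)
      + L⁻¹ / 2 * ‖gradient f z - gradient f x‖ ^ 2 ≤ f z := by
    intro x z
    set D := gradient f z - gradient f x with hD
    -- Compare lower and upper bounds at the point reached from z by a gradient step of length L⁻¹
    -- for f - ⟨∇f(x), ·⟩.
    have h1 := add_inner_gradient_le hc hf x (z - L⁻¹ • D)
    have h2 := le_quadratic_upper_bound hf hL z (z - L⁻¹ • D)
    have e1 : z - L⁻¹ • D - x = (z - x) - L⁻¹ • D := by abel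
    have e2 : z - L⁻¹ • D - z = -(L⁻¹ • D) := by abel
    have e3 : (inner ℝ (gradient f z) D : ℝ) - inner ℝ (gradient f x) D = ‖D‖ ^ 2 := by
      rw [← inner_sub_left, real_inner_self_eq_norm_sq]
    rw [e1, inner_sub_right, inner_smul_right] at h1
    rw [e2, inner_neg_right, inner_smul_right, norm_neg, norm_smul, mul_pow,
      Real.norm_of_nonneg (inv_pos.2 hL0).le] at h2
    have e4 : L / 2 * (L⁻¹ ^ 2 * ‖D‖ ^ 2) = L⁻¹ / 2 * ‖D‖ ^ 2 := by field_simp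
    rw [e4] at h2
    have e5 := congrArg (fun r => L⁻¹ * r) e3
    simp only [mul_sub] at e5
    linarith
  have h1 := key x z
  have h2 := key z x
  rw [norm_sub_rev] at h1
  have e : (inner ℝ (gradient f x) (z - x) : ℝ) = - inner ℝ (gradient f x) (x - z) := by
    rw [← inner_neg_right, neg_sub]
  rw [inner_sub_left]
  linarith

end Smooth

/-! ### Inexact iteration of averaged operators. -/

section KrasnoselskiiMann

variable {H : Type*} [NormedAddCommGroup H] [InnerProductSpace ℝ H]

/-- Averaged operators. -/
def IsAveraged (β : ℝ) (T : H → H) : Prop :=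
  ∀ x z, ‖T x - T z‖ ^ 2 + β * ‖(x - T x) - (z - T z)‖ ^ 2 ≤ ‖x - z‖ ^ 2

omit [InnerProductSpace ℝ H] in
theorem IsAveraged.norm_sub_le {β : ℝ} (hβ : 0 < β) {T : H → H} (hT : IsAveraged β T) (x z : H) :
    ‖T x - T z‖ ≤ ‖x - z‖ := by
  refine le_of_sq_le_sq ?_ (norm_nonneg _)
  have := hT x z
  have : 0 ≤ β * ‖(x - T x) - (z - T z)‖ ^ 2 := by positivity
  linarith

theorem exists_tendsto_of_le_add_summable {d e : ℕ → ℝ} (hd : ∀ k, 0 ≤ d k) (he : ∀ k, 0 ≤ e k)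
    (hsum : Summable e) (h : ∀ k, d (k + 1) ≤ d k + e k) : ∃ l, Tendsto d atTop (𝓝 l) := by
  have hanti : Antitone fun k => d k - ∑ i ∈ Finset.range k, e i :=
    antitone_nat_of_succ_le fun k => by
      rw [Finset.sum_range_succ]
      linarith [h k]
  have hbdd : BddBelow (Set.range fun k => d k - ∑ i ∈ Finset.range k, e i) := by
    refine ⟨-∑' i, e i, ?_⟩
    rintro _ ⟨k, rfl⟩
    have := hsum.sum_le_tsum (Finset.range k) fun i _ => he i
    dsimp only
    linarith [hd k]
  have := (tendsto_atTop_ciInf hanti hbdd).add hsum.hasSum.tendsto_sum_nat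
  simp only [sub_add_cancel] at this
  exact ⟨_, this⟩

variable {β : ℝ} {T : H → H} {x : ℕ → H}

omit [InnerProductSpace ℝ H] in
theorem IsAveraged.exists_tendsto_norm_sub (hβ : 0 < β) (hT : IsAveraged β T)
    (hx : Summable fun k => ‖x (k + 1) - T (x k)‖) {s : H} (hs : T s = s) :
    ∃ l, Tendsto (fun k => ‖x k - s‖) atTop (𝓝 l) ∧
      Tendsto (fun k => ‖T (x k) - s‖) atTop (𝓝 l) := by
  have h1 : ∀ k, ‖T (x k) - s‖ ≤ ‖x k - s‖ := fun k => by
    simpa only [hs] using hT.norm_sub_le hβ (x k) s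
  have h2 : ∀ k, ‖x (k + 1) - s‖ ≤ ‖x (k + 1) - T (x k)‖ + ‖T (x k) - s‖ := fun k =>
    norm_sub_le_norm_sub_add_norm_sub _ _ _
  obtain ⟨l, hl⟩ := exists_tendsto_of_le_add_summable (d := fun k => ‖x k - s‖)
    (fun k => norm_nonneg _) (fun k => norm_nonneg _) hx (fun k => by linarith [h1 k, h2 k])
  refine ⟨l, hl, tendsto_of_tendsto_of_tendsto_of_le_of_le
    (g := fun k => ‖x (k + 1) - s‖ - ‖x (k + 1) - T (x k)‖) ?_ hl
    (fun k => by dsimp only; linarith [h2 k]) h1⟩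
  simpa using (hl.comp (tendsto_add_atTop_nat 1)).sub hx.tendsto_atTop_zero

omit [InnerProductSpace ℝ H] in
theorem IsAveraged.tendsto_sub_map (hβ : 0 < β) (hT : IsAveraged β T)
    (hx : Summable fun k => ‖x (k + 1) - T (x k)‖) {s : H} (hs : T s = s) :
    Tendsto (fun k => x k - T (x k)) atTop (𝓝 0) := by
  obtain ⟨l, h1, h2⟩ := hT.exists_tendsto_norm_sub hβ hx hs
  refine tendsto_zero_of_norm_sq_le
    (a := fun k => β⁻¹ * (‖x k - s‖ ^ 2 - ‖T (x k) - s‖ ^ 2)) (fun k => ?_)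
    (by simpa using ((h1.pow 2).sub (h2.pow 2)).const_mul β⁻¹)
  have := hT (x k) s
  rw [hs, sub_self, sub_zero] at this
  rw [inv_mul_eq_div, le_div_iff₀ hβ]
  linarith

/-- Along an ultrafilter every bounded scalar sequence converges; the limits depend linearly and
boundedly on w, so Riesz represents them by a point. -/
theorem exists_weak_limit_ultrafilter [CompleteSpace H] {C : ℝ} (hC : ∀ k, ‖x k‖ ≤ C)
    (U : Ultrafilter ℕ) :
    ∃ a : H, ∀ w, Tendsto (fun k => (inner ℝ (x k) w : ℝ)) U (𝓝 (inner ℝ a w)) := by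
  have hbd : ∀ w k, |(inner ℝ (x k) w : ℝ)| ≤ C * ‖w‖ := fun w k =>
    (abs_real_inner_le_norm _ _).trans (by gcongr; exact hC k)
  have hex : ∀ w, ∃ l : ℝ, |l| ≤ C * ‖w‖ ∧ Tendsto (fun k => (inner ℝ (x k) w : ℝ)) U (𝓝 l) := by
    intro w
    obtain ⟨l, hl, hle⟩ := (isCompact_Icc (a := -(C * ‖w‖)) (b := C * ‖w‖)).ultrafilter_le_nhds
      (U.map fun k => (inner ℝ (x k) w : ℝ)) (by
        rw [Ultrafilter.coe_map, le_principal_iff, mem_map]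
        exact Eventually.of_forall fun k => abs_le.1 (hbd w k))
    exact ⟨l, abs_le.2 hl, hle⟩
  choose l hl hlim using hex
  let A : H →ₗ[ℝ] ℝ :=
    { toFun := l
      map_add' := fun v w => tendsto_nhds_unique (hlim (v + w)) (by
        simpa only [inner_add_right] using (hlim v).add (hlim w))
      map_smul' := fun c v => tendsto_nhds_unique (hlim (c • v)) (by
        simpa only [inner_smul_right, smul_eq_mul, RingHom.id_apply] using
          (hlim v).const_mul c) }
  refine ⟨(InnerProductSpace.toDual ℝ H).symm (A.mkContinuous C hl), fun w => ?_⟩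
  rw [InnerProductSpace.toDual_symm_apply]
  exact hlim w

/-- Demiclosedness of `id - T` at `0`. -/
theorem IsAveraged.fixed_of_weak_limit (hβ : 0 < β) (hT : IsAveraged β T) {C : ℝ}
    (hC : ∀ k, ‖x k‖ ≤ C) {l : Filter ℕ} [l.NeBot]
    (hx : Tendsto (fun k => x k - T (x k)) l (𝓝 0)) {a : H}
    (ha : ∀ w, Tendsto (fun k => (inner ℝ (x k) w : ℝ)) l (𝓝 (inner ℝ a w))) : T a = a := by
  have hC0 : 0 ≤ C := (norm_nonneg _).trans (hC 0)
  have h1 : ∀ k, 2 * (inner ℝ (x k) (a - T a) - inner ℝ a (a - T a)) + ‖a - T a‖ ^ 2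
      ≤ ‖x k - T (x k)‖ * (‖x k - T (x k)‖ + 2 * (C + ‖a‖)) := by
    intro k
    have h2 : ‖x k - T a‖ ≤ ‖x k - T (x k)‖ + ‖x k - a‖ :=
      (norm_sub_le_norm_sub_add_norm_sub _ (T (x k)) _).trans
        (by gcongr; exact hT.norm_sub_le hβ _ _)
    have h3 : ‖x k - a‖ ≤ C + ‖a‖ := (_root_.norm_sub_le _ _).trans (by gcongr; exact hC k)
    have h4 := pow_le_pow_left₀ (norm_nonneg _) h2 2
    have h5 := norm_add_sq_real (x k - a) (a - T a)
    rw [sub_add_sub_cancel, inner_sub_left] at h5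
    have h6 := mul_le_mul_of_nonneg_left h3 (norm_nonneg (x k - T (x k)))
    linarith
  have hn : Tendsto (fun k => ‖x k - T (x k)‖) l (𝓝 0) := by simpa using hx.norm
  have h2 := le_of_tendsto_of_tendsto'
    ((((ha (a - T a)).sub_const (inner ℝ a (a - T a))).const_mul 2).add_const (‖a - T a‖ ^ 2))
    (hn.mul (hn.add_const (2 * (C + ‖a‖)))) h1
  rw [sub_self, mul_zero, zero_add, zero_mul] at h2
  have h3 : ‖a - T a‖ = 0 := (pow_eq_zero_iff two_ne_zero).1 (le_antisymm h2 (sq_nonneg _))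
  exact (sub_eq_zero.1 (norm_eq_zero.1 h3)).symm

/-- Weak convergence of the Krasnosel'skii–Mann iteration with summable errors. -/
theorem IsAveraged.exists_weaklyTendsto [CompleteSpace H] (hβ : 0 < β) (hT : IsAveraged β T)
    (hx : Summable fun k => ‖x (k + 1) - T (x k)‖) (hfix : ∃ s, T s = s) :
    ∃ a, T a = a ∧ WeaklyTendsto x a := by
  obtain ⟨s, hs⟩ := hfix
  have hbdd : ∃ C, ∀ k, ‖x k‖ ≤ C := by
    obtain ⟨l, hl, -⟩ := hT.exists_tendsto_norm_sub hβ hx hs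
    obtain ⟨C, hC⟩ := hl.bddAbove_range
    refine ⟨‖s‖ + C, fun k => ?_⟩
    have h1 := hC ⟨k, rfl⟩
    have h2 : ‖x k‖ ≤ ‖s‖ + ‖x k - s‖ := norm_le_norm_add_norm_sub' _ _
    dsimp only at h1
    linarith
  obtain ⟨C, hC⟩ := hbdd
  choose a ha using fun U : Ultrafilter ℕ => exists_weak_limit_ultrafilter hC U
  have hafix : ∀ U : Ultrafilter ℕ, (U : Filter ℕ) ≤ atTop → T (a U) = a U := fun U hU =>
    hT.fixed_of_weak_limit hβ hC ((hT.tendsto_sub_map hβ hx hs).mono_left hU) (ha U)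
  -- Opial's argument: the distances to both fixed points converge, hence so does the inner product
  -- with their difference, and both weak limits give it the same value.
  have huniq : ∀ U V : Ultrafilter ℕ, (U : Filter ℕ) ≤ atTop → (V : Filter ℕ) ≤ atTop →
      a U = a V := by
    intro U V hU hV
    obtain ⟨l, hl, -⟩ := hT.exists_tendsto_norm_sub hβ hx (hafix U hU)
    obtain ⟨l', hl', -⟩ := hT.exists_tendsto_norm_sub hβ hx (hafix V hV)
    have e : ∀ k, (inner ℝ (x k) (a U - a V) : ℝ) =
        (‖x k - a V‖ ^ 2 - ‖x k - a U‖ ^ 2 + ‖a U‖ ^ 2 - ‖a V‖ ^ 2) / 2 := by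
      intro k
      rw [norm_sub_sq_real, norm_sub_sq_real, inner_sub_right]
      ring
    have hlim : Tendsto (fun k => (inner ℝ (x k) (a U - a V) : ℝ)) atTop
        (𝓝 ((l' ^ 2 - l ^ 2 + ‖a U‖ ^ 2 - ‖a V‖ ^ 2) / 2)) := by
      simp only [e]
      exact ((((hl'.pow 2).sub (hl.pow 2)).add_const _).sub_const _).div_const _
    have h1 := tendsto_nhds_unique (ha U (a U - a V)) (hlim.mono_left hU)
    have h2 := tendsto_nhds_unique (ha V (a U - a V)) (hlim.mono_left hV)
    have h3 : (inner ℝ (a U - a V) (a U - a V) : ℝ) = 0 := by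
      rw [inner_sub_left, h1, h2, sub_self]
    exact sub_eq_zero.1 (inner_self_eq_zero.1 h3)
  obtain ⟨U₀, hU₀⟩ := Ultrafilter.exists_le (atTop : Filter ℕ)
  refine ⟨a U₀, hafix U₀ hU₀, fun w => ?_⟩
  rw [tendsto_iff_ultrafilter]
  intro U hU
  rw [huniq U₀ U hU₀ hU]
  exact ha U w

theorem WeaklyTendsto.tendsto [FiniteDimensional ℝ H] {a : H} (h : WeaklyTendsto x a) :
    Tendsto x atTop (𝓝 a) := by
  set b := stdOrthonormalBasis ℝ H
  rw [← b.sum_repr a]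
  have e : x = fun k => ∑ i, b.repr (x k) i • b i := funext fun k => (b.sum_repr (x k)).symm
  rw [e]
  refine tendsto_finsetSum _ fun i _ => Tendsto.smul_const ?_ (b i)
  simp only [OrthonormalBasis.repr_apply_apply]
  simpa only [real_inner_comm] using h (b i)

end KrasnoselskiiMann

/-! ### The forward-backward operator. -/

section ForwardBackward

variable {H : Type*} [NormedAddCommGroup H] [InnerProductSpace ℝ H] [CompleteSpace H] {f : H → ℝ}
  {φ : H → EReal} {γ L : ℝ}

theorem isAveraged_forwardBackward (hc : ConvexOn ℝ Set.univ f) (hf : Differentiable ℝ f)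
    (hL0 : 0 < L) (hL : ∀ x z, ‖gradient f x - gradient f z‖ ≤ L * ‖x - z‖)
    (hφ : GammaZero φ) (hγ : 0 < γ) (hγL : γ < 2 / L) :
    ∃ β > 0, IsAveraged β (fun x => prox γ φ (x - γ • gradient f x)) := by
  set κ := γ * (2 / L - γ) with hκ
  have hκ0 : 0 < κ := mul_pos hγ (sub_pos.2 hγL)
  -- Cocoercivity and monotonicity leave the gain ‖v - γD‖² + κ‖D‖², while ‖v‖² ≤ 2‖v - γD‖² +
  -- 2γ²‖D‖²; β is the largest factor matching both terms.
  refine ⟨min (1 / 2) (κ / (2 * γ ^ 2)), by positivity, fun x z => ?_⟩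
  obtain ⟨a, ha⟩ := hφ.exists_isSubgrad_prox hγ (x - γ • gradient f x)
  obtain ⟨a', ha'⟩ := hφ.exists_isSubgrad_prox hγ (z - γ • gradient f z)
  have h1 := ha.monotone ha'
  dsimp only
  set p := prox γ φ (x - γ • gradient f x)
  set p' := prox γ φ (z - γ • gradient f z)
  set D := gradient f x - gradient f z with hD
  set v := (x - p) - (z - p') with hv
  have e1 : γ⁻¹ • (x - γ • gradient f x - p) - γ⁻¹ • (z - γ • gradient f z - p')
      = γ⁻¹ • (v - γ • D) := by rw [hv, hD]; module
  rw [e1, inner_smul_left, RCLike.conj_to_real] at h1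
  have h2 : 0 ≤ (inner ℝ (v - γ • D) (p - p') : ℝ) :=
    nonneg_of_mul_nonneg_right h1 (inv_pos.2 hγ)
  have h3 := norm_gradient_sub_sq_le hc hf hL0 hL x z
  rw [← hD] at h3
  have h4 := norm_add_sq_real (v - γ • D) (p - p')
  rw [show v - γ • D + (p - p') = (x - z) - γ • D by rw [hv]; abel, norm_sub_sq_real (x - z),
    inner_smul_right, norm_smul, mul_pow, Real.norm_of_nonneg hγ.le, real_inner_comm] at h4
  have h5 := mul_le_mul_of_nonneg_left h3 hγ.le
  have h6 : ‖v‖ ^ 2 ≤ 2 * ‖v - γ • D‖ ^ 2 + 2 * (γ ^ 2 * ‖D‖ ^ 2) := by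
    have h7 := parallelogram_law_with_norm ℝ (v - γ • D) (γ • D)
    rw [sub_add_cancel, norm_smul, Real.norm_of_nonneg hγ.le] at h7
    nlinarith [sq_nonneg ‖v - γ • D - γ • D‖]
  have h7 : min (1 / 2) (κ / (2 * γ ^ 2)) * ‖v‖ ^ 2 ≤ ‖v - γ • D‖ ^ 2 + κ * ‖D‖ ^ 2 := by
    calc min (1 / 2) (κ / (2 * γ ^ 2)) * ‖v‖ ^ 2
        ≤ min (1 / 2) (κ / (2 * γ ^ 2)) * (2 * ‖v - γ • D‖ ^ 2 + 2 * (γ ^ 2 * ‖D‖ ^ 2)) := by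
          gcongr
      _ = min (1 / 2) (κ / (2 * γ ^ 2)) * (2 * ‖v - γ • D‖ ^ 2)
          + min (1 / 2) (κ / (2 * γ ^ 2)) * (2 * (γ ^ 2 * ‖D‖ ^ 2)) := by ring
      _ ≤ 1 / 2 * (2 * ‖v - γ • D‖ ^ 2) + κ / (2 * γ ^ 2) * (2 * (γ ^ 2 * ‖D‖ ^ 2)) := by
          gcongr
          · exact min_le_left _ _
          · exact min_le_right _ _
      _ = _ := by field_simp
  have h8 : κ * ‖D‖ ^ 2 = (2 * γ * L⁻¹ - γ ^ 2) * ‖D‖ ^ 2 := by rw [hκ]; ring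
  linarith

/-- Both sides say that -∇f(x) is a subgradient of φ at x. Sufficiency for a minimum uses the
gradient inequality for f, necessity its directional derivatives along segments. -/
theorem prox_forward_eq_iff (hc : ConvexOn ℝ Set.univ f) (hf : Differentiable ℝ f)
    (hφ : GammaZero φ) (hγ : 0 < γ) {x : H} :
    prox γ φ (x - γ • gradient f x) = x ↔ IsMinimizer (fun z => (f z : EReal) + φ z) x := by
  have e : γ⁻¹ • (x - γ • gradient f x - x) = -gradient f x := by
    rw [sub_sub_cancel_left, smul_neg, smul_smul, inv_mul_cancel₀ hγ.ne', one_smul]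
  constructor
  · intro hx
    obtain ⟨a, ha⟩ := hφ.exists_isSubgrad_prox hγ (x - γ • gradient f x)
    rw [hx, e] at ha
    refine ⟨?_, fun z => le_of_forall_coe_le fun r hr => ?_⟩
    · dsimp only
      rw [ha.1, ← EReal.coe_add]
      exact EReal.coe_ne_top _
    · rw [coe_add_le_coe_iff] at hr
      have h1 := ha.2 z _ hr
      have h2 := add_inner_gradient_le hc hf x z
      rw [inner_neg_left] at h1
      dsimp only
      rw [ha.1, ← EReal.coe_add, EReal.coe_le_coe_iff]
      linarith
  · rintro ⟨hx, hmin⟩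
    have hφx : φ x ≠ ⊤ := fun h => hx (by simp [h])
    obtain ⟨a, ha⟩ : ∃ a : ℝ, φ x = a := ⟨_, (EReal.coe_toReal hφx (hφ.ne_bot x)).symm⟩
    have hsub : IsSubgrad φ x a (γ⁻¹ • (x - γ • gradient f x - x)) := by
      refine ⟨ha, fun z r hz => ?_⟩
      have h1 : a - r ≤ inner ℝ (gradient f x) (z - x) := by
        refine le_inner_gradient hf fun t ht0 ht1 => ?_
        have h2 := hφ.convLsc.convex_le hz ha.le ht0.le (sub_nonneg.2 ht1) (by ring)
        rw [show t • z + (1 - t) • x = x + t • (z - x) by module] at h2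
        have h3 := (hmin (x + t • (z - x))).trans (add_le_add le_rfl h2)
        dsimp only at h3
        rw [ha, ← EReal.coe_add, ← EReal.coe_add, EReal.coe_le_coe_iff] at h3
        linarith
      rw [e, inner_neg_left]
      linarith
    exact hsub.prox_eq hγ

end ForwardBackward
end PDFB
end

/-! ### Reduction to one operator on the Hilbert sum; gap estimates. -/

noncomputable section
namespace PDFB

/-- The closed sublevel sets at integer heights cover the space, so by Baire one has interior
points; a convex function bounded above near one point is continuous. -/
theorem ConvLsc.continuous_toReal {E : Type*} [NormedAddCommGroup E] [NormedSpace ℝ E]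
    [CompleteSpace E] {φ : E → EReal} (h : ConvLsc φ) (hfin : ∀ x, φ x ≠ ⊤) :
    Continuous fun x => (φ x).toReal := by
  have hcoe : ∀ x, φ x = ((φ x).toReal : EReal) := fun x =>
    (EReal.coe_toReal (hfin x) (h.ne_bot x)).symm
  have hconv : ConvexOn ℝ Set.univ fun x => (φ x).toReal := by
    refine ⟨convex_univ, fun x _ y _ a b ha hb hab => ?_⟩
    have := h.convex_le (hcoe x).le (hcoe y).le ha hb hab
    rwa [hcoe (a • x + b • y), EReal.coe_le_coe_iff] at this
  have hclosed : ∀ n : ℕ, IsClosed {x | φ x ≤ ((n : ℝ) : EReal)} := fun n =>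
    h.lsc.isClosed_preimage _
  have hunion : ⋃ n : ℕ, {x | φ x ≤ ((n : ℝ) : EReal)} = Set.univ := by
    refine Set.eq_univ_of_forall fun x => Set.mem_iUnion.2 ?_
    obtain ⟨n, hn⟩ := exists_nat_ge (φ x).toReal
    refine ⟨n, ?_⟩
    change φ x ≤ ((n : ℝ) : EReal)
    rw [hcoe x]
    exact EReal.coe_le_coe_iff.2 hn
  obtain ⟨n, x₀, hx₀⟩ := nonempty_interior_of_iUnion_of_closed hclosed hunion
  have hbdd : IsBoundedUnder (· ≤ ·) (𝓝 x₀) fun x => (φ x).toReal := by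
    refine isBoundedUnder_of_eventually_le (a := (n : ℝ)) ?_
    filter_upwards [mem_interior_iff_mem_nhds.1 hx₀] with x hx
    have hx' : φ x ≤ ((n : ℝ) : EReal) := hx
    rwa [hcoe x, EReal.coe_le_coe_iff] at hx'
  have hiff := (hconv.continuousOn_tfae isOpen_univ Set.univ_nonempty).out 3 1
  exact continuousOn_univ.1 (hiff.1 ⟨x₀, Set.mem_univ _, hbdd⟩)

variable {H : Type*} [NormedAddCommGroup H] [InnerProductSpace ℝ H] [CompleteSpace H]
variable {m : ℕ} {G : Fin m → Type*} [∀ i, NormedAddCommGroup (G i)]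
  [∀ i, InnerProductSpace ℝ (G i)] [∀ i, CompleteSpace (G i)]

/-- The operator `x ↦ (Bᵢ x)ᵢ` into the Hilbert sum. -/
def stack (B : ∀ i, H →L[ℝ] G i) : H →L[ℝ] PiLp 2 G :=
  ((PiLp.continuousLinearEquiv 2 ℝ G).symm : (∀ i, G i) →L[ℝ] PiLp 2 G).comp
    (ContinuousLinearMap.pi B)

/-- The separable sum `q ↦ ∑ᵢ hᵢ(qᵢ)`. -/
def sepSum (h : ∀ i, G i → EReal) (q : PiLp 2 G) : EReal := ∑ i, h i (q i)

omit [CompleteSpace H] [∀ i, CompleteSpace (G i)] in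
theorem stack_apply (B : ∀ i, H →L[ℝ] G i) (x : H) (i : Fin m) : stack B x i = B i x := rfl

omit [CompleteSpace H] [∀ i, CompleteSpace (G i)] in
theorem norm_stack_sq_le (B : ∀ i, H →L[ℝ] G i) (x : H) :
    ‖stack B x‖ ^ 2 ≤ (∑ i, ‖B i‖ ^ 2) * ‖x‖ ^ 2 := by
  rw [PiLp.norm_sq_eq_of_L2, Finset.sum_mul]
  refine Finset.sum_le_sum fun i _ => ?_
  rw [← mul_pow]
  exact pow_le_pow_left₀ (norm_nonneg _) ((B i).le_opNorm x) 2

theorem adjoint_stack (B : ∀ i, H →L[ℝ] G i) (y : PiLp 2 G) :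
    ContinuousLinearMap.adjoint (stack B) y = ∑ i, ContinuousLinearMap.adjoint (B i) (y i) := by
  refine ext_inner_right ℝ fun x => ?_
  rw [ContinuousLinearMap.adjoint_inner_left, sum_inner, PiLp.inner_apply]
  simp only [ContinuousLinearMap.adjoint_inner_left, stack_apply]

omit [∀ i, CompleteSpace (G i)] in
theorem convLsc_sepSum {h : ∀ i, G i → EReal} (hh : ∀ i, GammaZero (h i)) :
    ConvLsc (sepSum h) :=
  ConvLsc.sum Finset.univ fun i =>
    (hh i).convLsc.comp ((ContinuousLinearMap.proj i).comp
      (PiLp.continuousLinearEquiv 2 ℝ G : PiLp 2 G →L[ℝ] ∀ i, G i))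

omit [CompleteSpace H] [∀ i, CompleteSpace (G i)] in
theorem gammaZero_nonsmooth {g : H → EReal} (hg : GammaZero g) {h : ∀ i, G i → EReal}
    (hh : ∀ i, GammaZero (h i)) {B : ∀ i, H →L[ℝ] G i} (hz : ∃ z, nonsmooth g h B z ≠ ⊤) :
    GammaZero (nonsmooth g h B) := by
  have := hg.convLsc.add ((convLsc_sepSum hh).comp (stack B))
  exact ⟨this.ne_bot, hz, this.lsc, this.convex⟩

omit [∀ i, CompleteSpace (G i)] in
theorem isSubgrad_sepSum {h : ∀ i, G i → EReal} (hh : ∀ i x, h i x ≠ ⊥) {q ξ : PiLp 2 G}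
    {b : Fin m → ℝ} (hb : ∀ i, IsSubgrad (h i) (q i) (b i) (ξ i)) :
    IsSubgrad (sepSum h) q (∑ i, b i) ξ := by
  refine ⟨?_, fun z r hz => ?_⟩
  · rw [sepSum, coe_sum_ereal]
    exact Finset.sum_congr rfl fun i _ => (hb i).1
  · obtain ⟨s, hs, hsr⟩ := exists_coe_of_sum_le (fun i => hh i (z i)) hz
    refine le_trans ?_ hsr
    rw [PiLp.inner_apply, ← Finset.sum_add_distrib]
    exact Finset.sum_le_sum fun i _ => (hb i).2 (z i) (s i) (hs i).le

section Step

variable {γ σ τ : ℝ} {g : H → EReal} {h : ∀ i, G i → EReal} {B : ∀ i, H →L[ℝ] G i} {u : H}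

/-- The parameter τγ/(1 + τ) results from merging ‖x - u‖²/2 and the proximal term ‖x - x̄‖²/(2τ)
into one square; unscaling restores the two residuals. -/
theorem isSubgrad_innerStep_fst (hγ : 0 < γ) (hτ : 0 < τ) (hg : GammaZero g)
    (s : H × (∀ i, G i)) :
    ∃ a, IsSubgrad g (innerStep γ σ τ g h B u s).1 a
      (γ⁻¹ • (τ⁻¹ • (s.1 - (innerStep γ σ τ g h B u s).1)
        - ContinuousLinearMap.adjoint (stack B) (WithLp.toLp 2 s.2) + u
        - (innerStep γ σ τ g h B u s).1)) := by
  obtain ⟨a, ha⟩ := hg.exists_isSubgrad_prox (t := τ * γ / (1 + τ)) (by positivity)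
    ((1 + τ)⁻¹ • (s.1 - τ • (∑ i, ContinuousLinearMap.adjoint (B i) (s.2 i)) + τ • u))
  refine ⟨a, ?_⟩
  rw [adjoint_stack]
  have hx : (innerStep γ σ τ g h B u s).1 = prox (τ * γ / (1 + τ)) g
    ((1 + τ)⁻¹ • (s.1 - τ • (∑ i, ContinuousLinearMap.adjoint (B i) (s.2 i)) + τ • u)) := rfl
  rw [hx]
  generalize prox (τ * γ / (1 + τ)) g _ = x' at ha ⊢
  convert ha using 1
  have h1 : 1 + τ ≠ 0 := by positivity
  match_scalars <;> (field_simp; try ring)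

theorem isSubgrad_innerStep_snd (hγ : 0 < γ) (hσ : 0 < σ) (hh : ∀ i, GammaZero (h i))
    (s : H × (∀ i, G i)) (i : Fin m) :
    ∃ b, IsSubgrad (h i) (pdPoint σ (stack B) s.1 (WithLp.toLp 2 s.2)
      (innerStep γ σ τ g h B u s).1 (WithLp.toLp 2 (innerStep γ σ τ g h B u s).2) i) b
      (γ⁻¹ • (innerStep γ σ τ g h B u s).2 i) := by
  set x' := (innerStep γ σ τ g h B u s).1 with hx'
  obtain ⟨b, hb⟩ := (hh i).isSubgrad_prox_conj (t := σ / γ) (by positivity)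
    (γ⁻¹ • (s.2 i + σ • B i ((2 : ℝ) • x' - s.1)))
  refine ⟨b, ?_⟩
  have e1 : (innerStep γ σ τ g h B u s).2 i = γ • prox (σ / γ) (conj (h i))
    (γ⁻¹ • (s.2 i + σ • B i ((2 : ℝ) • x' - s.1))) := rfl
  set π := prox (σ / γ) (conj (h i)) (γ⁻¹ • (s.2 i + σ • B i ((2 : ℝ) • x' - s.1)))
  have e2 : pdPoint σ (stack B) s.1 (WithLp.toLp 2 s.2) x'
      (WithLp.toLp 2 (innerStep γ σ τ g h B u s).2) i =
      (σ / γ)⁻¹ • (γ⁻¹ • (s.2 i + σ • B i ((2 : ℝ) • x' - s.1)) - π) := by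
    rw [pdPoint, PiLp.add_apply, PiLp.smul_apply, PiLp.sub_apply, stack_apply]
    dsimp only
    rw [e1]
    match_scalars <;> field_simp
  rw [e2, e1, smul_smul, inv_mul_cancel₀ hγ.ne', one_smul]
  exact hb

theorem pdStep_innerStep (hγ : 0 < γ) (hσ : 0 < σ) (hτ : 0 < τ) (hg : GammaZero g)
    (hh : ∀ i, GammaZero (h i)) (s : H × (∀ i, G i)) :
    PDStep γ σ τ u g (sepSum h) (stack B) s.1 (WithLp.toLp 2 s.2)
      (innerStep γ σ τ g h B u s).1 (WithLp.toLp 2 (innerStep γ σ τ g h B u s).2) where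
  primal := isSubgrad_innerStep_fst hγ hτ hg s
  dual := by
    choose b hb using isSubgrad_innerStep_snd (τ := τ) (g := g) (B := B) (u := u) hγ hσ hh s
    exact ⟨_, isSubgrad_sepSum (fun i => (hh i).ne_bot) hb⟩

omit [∀ i, CompleteSpace (G i)] in
theorem isPrimalSol_prox (hγ : 0 < γ) (hg : GammaZero g) (hh : ∀ i, GammaZero (h i))
    (hN : GammaZero (nonsmooth g h B)) (u : H) :
    ∃ gp Fp P, IsPrimalSol γ u g (sepSum h) (stack B) (prox γ (nonsmooth g h B) u) gp Fp P ∧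
      proxObjective γ (nonsmooth g h B) u (prox γ (nonsmooth g h B) u) = P ∧
      ∀ (z : H) (r : ℝ), proxObjective γ (nonsmooth g h B) u z ≤ r →
        P + ‖z - prox γ (nonsmooth g h B) u‖ ^ 2 / 2 ≤ r := by
  obtain ⟨a, ha⟩ := hN.exists_isSubgrad_prox hγ u
  set p := prox γ (nonsmooth g h B) u
  obtain ⟨gp, Fp, hgp, hFp, -⟩ := exists_coe_of_add_le (hg.ne_bot p)
    ((convLsc_sepSum hh).ne_bot (stack B p)) (r := a) ha.1.le
  have haval : a = gp + Fp := by
    have : g p + sepSum h (stack B p) = a := ha.1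
    rw [hgp, hFp, ← EReal.coe_add, EReal.coe_eq_coe_iff] at this
    exact this.symm
  refine ⟨gp, Fp, ‖p - u‖ ^ 2 / 2 + γ * gp + γ * Fp, ⟨hgp, hFp, rfl, fun z r s hr hs => ?_⟩,
    ?_, fun z r hr => ?_⟩
  · have h1 : nonsmooth g h B z ≤ ((r + s : ℝ) : EReal) := by
      rw [EReal.coe_add]
      exact add_le_add hr hs
    have := ha.prox_quadratic_growth hγ h1
    rw [haval] at this
    nlinarith [sq_nonneg ‖z - p‖]
  · rw [proxObjective_of_eq ha.1, haval]
    congr 1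
    ring
  · have := ha.prox_quadratic_growth hγ ((proxObjective_le_coe_iff hγ).1 hr)
    rw [haval, mul_div_cancel₀ _ hγ.ne'] at this
    linarith

omit [CompleteSpace H] [∀ i, CompleteSpace (G i)] in
/-- Weak duality. -/
theorem dualObjective_le (hγ : 0 < γ) {z : H} {q y : ∀ i, G i} {r : ℝ} {s : Fin m → ℝ}
    (hz : g z ≤ r) (hq : ∀ i, h i (q i) ≤ s i) :
    dualObjective γ g h B u y ≤
      ((‖z - u‖ ^ 2 / 2 + γ * r + ∑ i, inner ℝ (B i z - q i) (y i) + γ * ∑ i, s i : ℝ) :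
        EReal) := by
  have h1 : (⨅ z : H, proxObjective γ g u z + ((∑ i, (inner ℝ (B i z) (y i) : ℝ) : ℝ) : EReal))
      ≤ ((‖z - u‖ ^ 2 / 2 + γ * r + ∑ i, inner ℝ (B i z) (y i) : ℝ) : EReal) := by
    refine (iInf_le _ z).trans ?_
    rw [EReal.coe_add]
    refine add_le_add ((proxObjective_le_coe_iff hγ).2 ?_) le_rfl
    rwa [add_sub_cancel_left, mul_div_cancel_left₀ _ hγ.ne']
  have h2 : ((∑ i, γ * (inner ℝ (q i) (γ⁻¹ • y i) - s i) : ℝ) : EReal) ≤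
      ∑ i, (γ : EReal) * conj (h i) (γ⁻¹ • y i) := by
    rw [coe_sum_ereal]
    refine Finset.sum_le_sum fun i _ => ?_
    rw [EReal.coe_mul]
    exact mul_le_mul_of_nonneg_left (le_conj (hq i) _) (EReal.coe_nonneg.2 hγ.le)
  refine (EReal.sub_le_sub h1 h2).trans ?_
  rw [← EReal.coe_sub, EReal.coe_le_coe_iff]
  have e : ∑ i, γ * (inner ℝ (q i) (γ⁻¹ • y i) - s i)
      = ∑ i, inner ℝ (q i) (y i) - γ * ∑ i, s i := by
    rw [Finset.mul_sum, ← Finset.sum_sub_distrib]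
    refine Finset.sum_congr rfl fun i _ => ?_
    rw [inner_smul_right, mul_sub, ← mul_assoc, mul_inv_cancel₀ hγ.ne', one_mul]
  simp only [inner_sub_left, Finset.sum_sub_distrib]
  rw [e]
  linarith

omit [∀ i, CompleteSpace (G i)] in
-- By weak duality the gap is at least the primal excess over P, which is at least ‖x - p‖²/2.
theorem norm_sub_prox_sq_lt_of_gap_lt (hγ : 0 < γ) (hg : GammaZero g)
    (hh : ∀ i, GammaZero (h i)) (hN : GammaZero (nonsmooth g h B)) {s : H × (∀ i, G i)} {δ : ℝ}
    (hgap : gap γ g h B u s < δ) : ‖s.1 - prox γ (nonsmooth g h B) u‖ ^ 2 < 2 * δ := by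
  obtain ⟨gp, Fp, P, hp, -, hgrow⟩ := isPrimalSol_prox hγ hg hh hN u
  set p := prox γ (nonsmooth g h B) u
  obtain ⟨b, hb, hbF⟩ := exists_coe_of_sum_le (fun i => (hh i).ne_bot (stack B p i)) hp.F_eq.le
  have hD : dualObjective γ g h B u s.2 ≤ P := by
    refine (dualObjective_le (q := fun i => B i p) hγ hp.g_eq.le fun i => (hb i).le).trans ?_
    rw [EReal.coe_le_coe_iff, hp.value]
    simp only [sub_self, inner_zero_left, Finset.sum_const_zero, add_zero]
    gcongr
  have h1 : proxObjective γ (nonsmooth g h B) u s.1 - P < δ :=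
    (EReal.sub_le_sub le_rfl hD).trans_lt hgap
  have hbot : proxObjective γ (nonsmooth g h B) u s.1 ≠ ⊥ := fun h0 => by
    have := hgrow s.1 (P - 1) (by rw [h0]; exact bot_le)
    nlinarith [sq_nonneg ‖s.1 - p‖]
  have htop : proxObjective γ (nonsmooth g h B) u s.1 ≠ ⊤ := fun h0 => by
    rw [h0, EReal.top_sub_coe] at h1
    exact not_top_lt h1
  lift proxObjective γ (nonsmooth g h B) u s.1 to ℝ using ⟨htop, hbot⟩ with c hc
  rw [← EReal.coe_sub, EReal.coe_lt_coe_iff] at h1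
  have := hgrow s.1 c hc.ge
  linarith

omit [CompleteSpace H] [∀ i, CompleteSpace (G i)] in
theorem approxDual_zero_of_gap_eq_zero (hγ : 0 < γ) (hh : ∀ i, GammaZero (h i)) {p : H} {P : ℝ}
    (hP : proxObjective γ (nonsmooth g h B) u p = P) {y : ∀ i, G i}
    (hgap : gap γ g h B u (p, y) = 0) :
    ApproxDual γ u g (sepSum h) (stack B) P 0 (WithLp.toLp 2 y) := by
  intro z q r s hr hs
  obtain ⟨b, hb, hbs⟩ := exists_coe_of_sum_le (fun i => (hh i).ne_bot (q i)) hs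
  have h1 := dualObjective_le (u := u) (B := B) (q := fun i => q i) (y := y) hγ hr
    fun i => (hb i).le
  rw [gap, hP] at hgap
  dsimp only at hgap
  have h2 : (P : EReal) ≤ dualObjective γ g h B u y := by
    generalize dualObjective γ g h B u y = D at hgap
    induction D with
    | bot => simp at hgap
    | top => exact le_top
    | coe d =>
      rw [← EReal.coe_sub, EReal.coe_eq_zero] at hgap
      rw [EReal.coe_le_coe_iff]
      linarith
  have h3 := h2.trans h1
  rw [EReal.coe_le_coe_iff] at h3
  rw [PiLp.inner_apply]
  have h4 := mul_le_mul_of_nonneg_left hbs hγ.le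
  simp only [PiLp.sub_apply, stack_apply]
  linarith

/-- Upper bound for the gap after a primal-dual step. -/
theorem gap_innerStep_le (hγ : 0 < γ) (hσ : 0 < σ) (hτ : 0 < τ) (hg : GammaZero g)
    (hh : ∀ i, GammaZero (h i)) {Fr : PiLp 2 G → ℝ} (hFr : sepSum h = fun q => (Fr q : EReal))
    (s : H × (∀ i, G i)) {s' : H × (∀ i, G i)} (hs' : s' = innerStep γ σ τ g h B u s)
    {x x' : H} {y y' : PiLp 2 G} (hx : x = s.1) (hx' : x' = s'.1) (hy : y = WithLp.toLp 2 s.2)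
    (hy' : y' = WithLp.toLp 2 s'.2) :
    gap γ g h B u s' ≤
      ((γ * (Fr (stack B x') - Fr (pdPoint σ (stack B) x y x' y'))
      + inner ℝ (pdPoint σ (stack B) x y x' y' - stack B x') y'
      + ‖τ⁻¹ • (x - x') - ContinuousLinearMap.adjoint (stack B) (y - y')‖ ^ 2 / 2 : ℝ) :
        EReal) := by
  obtain ⟨a, ha⟩ := isSubgrad_innerStep_fst (σ := σ) (h := h) (B := B) (u := u) hγ hτ hg s
  choose b hb using isSubgrad_innerStep_snd (τ := τ) (g := g) (B := B) (u := u) hγ hσ hh s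
  rw [← hs', ← hx', ← hx, ← hy] at ha
  rw [← hs', ← hx', ← hx, ← hy, ← hy'] at hb
  set q := pdPoint σ (stack B) x y x' y' with hq
  set ρ := ‖τ⁻¹ • (x - x') - ContinuousLinearMap.adjoint (stack B) (y - y')‖ ^ 2 / 2 with hρ
  have hFq : Fr q = ∑ i, b i := by
    have h1 : sepSum h q = ((∑ i, b i : ℝ) : EReal) := by
      rw [sepSum, coe_sum_ereal]
      exact Finset.sum_congr rfl fun i _ => (hb i).1
    rw [hFr] at h1
    exact EReal.coe_eq_coe_iff.1 h1
  have hprim : proxObjective γ (nonsmooth g h B) u s'.1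
      = ((‖x' - u‖ ^ 2 / 2 + γ * (a + Fr (stack B x')) : ℝ) : EReal) := by
    rw [← hx']
    refine proxObjective_of_eq ?_
    have : nonsmooth g h B x' = g x' + sepSum h (stack B x') := rfl
    rw [this, ha.1, hFr, EReal.coe_add]
  -- x' minimizes the Lagrangian at y' only up to the residual of the step; strong convexity limits
  -- the loss to ρ.
  have hinf : ((‖x' - u‖ ^ 2 / 2 + γ * a + inner ℝ (stack B x') y' - ρ : ℝ) : EReal) ≤
      ⨅ z : H, proxObjective γ g u z +
        ((∑ i, (inner ℝ (B i z) (s'.2 i) : ℝ) : ℝ) : EReal) := by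
    refine le_iInf fun z => le_of_forall_coe_le fun r hr => ?_
    rw [add_comm, coe_add_le_coe_iff, proxObjective_le_coe_iff hγ] at hr
    have h1 := PDStep.lagrangian_le (y' := y') hγ ha hr
    have h2 : (inner ℝ (stack B z) y' : ℝ) = ∑ i, inner ℝ (B i z) (s'.2 i) := by
      rw [PiLp.inner_apply, hy']; rfl
    rw [mul_div_cancel₀ _ hγ.ne', h2] at h1
    rw [EReal.coe_le_coe_iff]
    linarith
  -- Fenchel equality at q, since γ⁻¹y' is a subgradient there.
  have hconj : ∑ i, (γ : EReal) * conj (h i) (γ⁻¹ • s'.2 i)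
      = ((inner ℝ q y' - γ * Fr q : ℝ) : EReal) := by
    rw [PiLp.inner_apply, hFq, Finset.mul_sum, ← Finset.sum_sub_distrib, coe_sum_ereal]
    refine Finset.sum_congr rfl fun i _ => ?_
    rw [(hb i).conj_eq (hh i).ne_bot, ← EReal.coe_mul, inner_smul_right, mul_sub, ← mul_assoc,
      mul_inv_cancel₀ hγ.ne', one_mul, hy']
  have hD : ((‖x' - u‖ ^ 2 / 2 + γ * a + inner ℝ (stack B x') y' - ρ
      - (inner ℝ q y' - γ * Fr q) : ℝ) : EReal) ≤ dualObjective γ g h B u s'.2 := by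
    rw [dualObjective, hconj, EReal.coe_sub]
    exact EReal.sub_le_sub hinf le_rfl
  rw [gap, hprim]
  refine (EReal.sub_le_sub le_rfl hD).trans ?_
  rw [← EReal.coe_sub, EReal.coe_le_coe_iff, inner_sub_left]
  linarith

end Step
end PDFB
end

/-! ### The inner loop and the error of its output. -/

noncomputable section
namespace PDFB

section InnerLoop

variable {H : Type*} [NormedAddCommGroup H] [InnerProductSpace ℝ H] [CompleteSpace H]
  {m : ℕ} {G : Fin m → Type*} [∀ i, NormedAddCommGroup (G i)]
  [∀ i, InnerProductSpace ℝ (G i)] [∀ i, CompleteSpace (G i)]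
  {γ σ τ : ℝ} {g : H → EReal} {h : ∀ i, G i → EReal} {B : ∀ i, H →L[ℝ] G i} {u : H}
  {s : ℕ → H × (∀ i, G i)}

theorem pdStep_of_innerStep (hγ : 0 < γ) (hσ : 0 < σ) (hτ : 0 < τ) (hg : GammaZero g)
    (hh : ∀ i, GammaZero (h i)) (hs : ∀ j, s (j + 1) = innerStep γ σ τ g h B u (s j)) (j : ℕ) :
    PDStep γ σ τ u g (sepSum h) (stack B) (s j).1 (WithLp.toLp 2 (s j).2)
      (s (j + 1)).1 (WithLp.toLp 2 (s (j + 1)).2) := by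
  rw [hs j]
  exact pdStep_innerStep hγ hσ hτ hg hh (s j)

omit [CompleteSpace H] [∀ i, CompleteSpace (G i)] in
theorem exists_pdForm_stack_lower_bound (hσ : 0 < σ) (hτ : 0 < τ)
    (hστ : σ * τ * ∑ i, ‖B i‖ ^ 2 < 1) :
    ∃ c > 0, ∀ x y, c * (‖x‖ ^ 2 + ‖y‖ ^ 2) ≤ pdForm σ τ (stack B) x y :=
  exists_pdForm_lower_bound hσ hτ (Finset.sum_nonneg fun _ _ => sq_nonneg _)
    (norm_stack_sq_le B) hστ

theorem exists_innerStep_norm_sub_sq_lt (hγ : 0 < γ) (hσ : 0 < σ) (hτ : 0 < τ)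
    (hστ : σ * τ * ∑ i, ‖B i‖ ^ 2 < 1) (hg : GammaZero g) (hh : ∀ i, GammaZero (h i))
    (hN : GammaZero (nonsmooth g h B)) (hs : ∀ j, s (j + 1) = innerStep γ σ τ g h B u (s j))
    {δ : ℝ} (hδ : 0 < δ) : ∃ j, ‖(s (j + 1)).1 - prox γ (nonsmooth g h B) u‖ ^ 2 < δ := by
  obtain ⟨c, hc, hform⟩ := exists_pdForm_stack_lower_bound (B := B) hσ hτ hστ
  obtain ⟨gp, Fp, P, hp, -, -⟩ := isPrimalSol_prox hγ hg hh hN u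
  exact exists_norm_sub_sq_lt (x := fun j => (s j).1) (y := fun j => WithLp.toLp 2 (s j).2)
    hc hform hγ hp (fun ε hε => exists_approxDual hγ hg.convLsc (convLsc_sepSum hh) hp hε)
    (pdStep_of_innerStep hγ hσ hτ hg hh hs) hδ

theorem exists_innerStep_gap_lt (hγ : 0 < γ) (hσ : 0 < σ) (hτ : 0 < τ)
    (hστ : σ * τ * ∑ i, ‖B i‖ ^ 2 < 1) (hg : GammaZero g) (hh : ∀ i, GammaZero (h i))
    (hN : GammaZero (nonsmooth g h B)) (hfin : ∀ i y, h i y ≠ ⊤)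
    (hs : ∀ j, s (j + 1) = innerStep γ σ τ g h B u (s j)) {δ : ℝ} (hδ : 0 < δ) :
    ∃ j, gap γ g h B u (s (j + 1)) < δ := by
  obtain ⟨c, hc, hform⟩ := exists_pdForm_stack_lower_bound (B := B) hσ hτ hστ
  obtain ⟨gp, Fp, P, hp, -, -⟩ := isPrimalSol_prox hγ hg hh hN u
  set Fr : PiLp 2 G → ℝ := fun q => ∑ i, (h i (q i)).toReal with hFr_def
  have hFr : sepSum h = fun q => (Fr q : EReal) := by
    funext q
    rw [hFr_def, coe_sum_ereal, sepSum]
    exact Finset.sum_congr rfl fun i _ =>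
      (EReal.coe_toReal (hfin i _) ((hh i).ne_bot _)).symm
  have hcont : Continuous Fr := continuous_finsetSum _ fun i _ =>
    ((hh i).convLsc.continuous_toReal (hfin i)).comp (PiLp.continuous_apply 2 G i)
  have hstep := pdStep_of_innerStep hγ hσ hτ hg hh hs
  have hF := convLsc_sepSum hh
  rw [hFr] at hp hF hstep
  obtain ⟨j, hj⟩ := exists_small_gap_bound (x := fun j => (s j).1)
    (y := fun j => WithLp.toLp 2 (s j).2) hc hform hcont hγ hg.convLsc hF hp hstep hδ
  exact ⟨j, (gap_innerStep_le hγ hσ hτ hg hh hFr (s j) (hs j) rfl rfl rfl rfl).trans_lt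
    (EReal.coe_lt_coe_iff.2 hj)⟩

theorem tendsto_innerStep_of_gap_eq_zero (hγ : 0 < γ) (hσ : 0 < σ) (hτ : 0 < τ)
    (hστ : σ * τ * ∑ i, ‖B i‖ ^ 2 < 1) (hg : GammaZero g) (hh : ∀ i, GammaZero (h i))
    (hN : GammaZero (nonsmooth g h B)) {y : ∀ i, G i}
    (hy : gap γ g h B u (prox γ (nonsmooth g h B) u, y) = 0)
    (hs : ∀ j, s (j + 1) = innerStep γ σ τ g h B u (s j)) :
    Tendsto (fun j => (s j).1) atTop (𝓝 (prox γ (nonsmooth g h B) u)) := by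
  obtain ⟨c, hc, hform⟩ := exists_pdForm_stack_lower_bound (B := B) hσ hτ hστ
  obtain ⟨gp, Fp, P, hp, hP, -⟩ := isPrimalSol_prox hγ hg hh hN u
  exact tendsto_of_exact_dual (y := fun j => WithLp.toLp 2 (s j).2) hc hform hγ hp
    (approxDual_zero_of_gap_eq_zero hγ hh hP hy) (pdStep_of_innerStep hγ hσ hτ hg hh hs)

theorem InnerOutput.norm_sub_le (hγ : 0 < γ) (hσ : 0 < σ) (hτ : 0 < τ)
    (hστ : σ * τ * ∑ i, ‖B i‖ ^ 2 < 1) (hg : GammaZero g) (hh : ∀ i, GammaZero (h i))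
    (hN : GammaZero (nonsmooth g h B)) (hs : ∀ j, s (j + 1) = innerStep γ σ τ g h B u (s j))
    {δ : ℝ} (hδ : 0 < δ) {xout : H} (hout : InnerOutput γ g h B u s δ xout) :
    ‖xout - prox γ (nonsmooth g h B) u‖ ≤ √2 * √δ := by
  rw [← Real.sqrt_mul zero_le_two]
  refine Real.le_sqrt_of_sq_le ?_
  obtain ⟨j, rfl, hj | hj⟩ | hlim := hout
  · exact (norm_sub_prox_sq_lt_of_gap_lt hγ hg hh hN hj).le
  · linarith
  · have ht : Tendsto (fun j => ‖(s j).1 - prox γ (nonsmooth g h B) u‖ ^ 2) atTop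
        (𝓝 (‖xout - prox γ (nonsmooth g h B) u‖ ^ 2)) := (hlim.sub_const _).norm.pow 2
    by_contra! hlt
    obtain ⟨N, hN'⟩ := eventually_atTop.1 (ht.eventually (lt_mem_nhds hlt))
    -- If the limit were at squared distance above 2δ, a whole tail would be; yet the loop restarted
    -- from its N-th iterate must come closer.
    obtain ⟨j, hj⟩ := exists_innerStep_norm_sub_sq_lt (s := fun j => s (N + j)) hγ hσ hτ hστ hg hh
      hN (fun j => hs (N + j)) (show 0 < 2 * δ by positivity)
    exact lt_asymm hj (hN' (N + (j + 1)) (by omega))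

end InnerLoop
end PDFB
end

theorem theorem4p7
    {H : Type*} [NormedAddCommGroup H] [InnerProductSpace ℝ H] [CompleteSpace H]
    {m : ℕ} (hm : 1 ≤ m) {G : Fin m → Type*} [∀ i, NormedAddCommGroup (G i)]
    [∀ i, InnerProductSpace ℝ (G i)] [∀ i, CompleteSpace (G i)]
    (f : H → ℝ) (hf_conv : ConvexOn ℝ Set.univ f) (hf_diff : Differentiable ℝ f)
    (L : ℝ) (hL : 0 < L)
    (hf_lip : ∀ x z, ‖gradient f x - gradient f z‖ ≤ L * ‖x - z‖)
    (g : H → EReal) (hg : PDFB.GammaZero g)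
    (h : ∀ i, G i → EReal) (hh : ∀ i, PDFB.GammaZero (h i))
    (B : ∀ i, H →L[ℝ] G i)
    (hsol : ∃ z, PDFB.IsMinimizer (PDFB.objective f g h B) z)
    (γ σ τ : ℝ) (hγ : 0 < γ) (hγL : γ < 2 / L) (hσ : 0 < σ) (hτ : 0 < τ)
    (hστ : σ * τ * ∑ i, ‖B i‖ ^ 2 < 1) :
    -- the inner loop always reaches the tolerance
    (∀ (u : H) (s₀ : H × (∀ i, G i)) (δ : ℝ), 0 < δ →
      (∃ j : ℕ, ‖((PDFB.innerStep γ σ τ g h B u)^[j + 1] s₀).1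
          - PDFB.prox γ (PDFB.nonsmooth g h B) u‖ ^ 2 < δ) ∧
      ((∀ i y, h i y ≠ ⊤) →
        ∃ j : ℕ, PDFB.gap γ g h B u ((PDFB.innerStep γ σ τ g h B u)^[j + 1] s₀)
          < (δ : EReal))) ∧
    -- its primal iterates converge if the dual of the inner subproblem has a solution
    (∀ (u : H) (s₀ : H × (∀ i, G i)),
      (∃ y, PDFB.gap γ g h B u (PDFB.prox γ (PDFB.nonsmooth g h B) u, y) = 0) →
      Tendsto (fun j => ((PDFB.innerStep γ σ τ g h B u)^[j] s₀).1) atTop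
        (𝓝 (PDFB.prox γ (PDFB.nonsmooth g h B) u))) ∧
    -- the outer iterates converge to a solution
    (∀ (x0 xbar0 : H) (y0 : ∀ i, G i) (δ : ℕ → ℝ), (∀ k, 0 < δ k) →
      Summable (fun k => Real.sqrt (δ k)) →
      ∀ (x u : ℕ → H) (s : ℕ → ℕ → H × (∀ i, G i)),
        PDFB.GeneratedBy γ σ τ f g h B x0 xbar0 y0 δ x u s →
        ∃ xs, PDFB.IsMinimizer (PDFB.objective f g h B) xs ∧ PDFB.WeaklyTendsto x xs ∧
          (FiniteDimensional ℝ H → Tendsto x atTop (𝓝 xs))) := by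
  have hobj : PDFB.objective f g h B = fun z => (f z : EReal) + PDFB.nonsmooth g h B z :=
    funext fun z => add_assoc _ _ _
  have hN : PDFB.GammaZero (PDFB.nonsmooth g h B) := by
    obtain ⟨z, hz, -⟩ := hsol
    refine PDFB.gammaZero_nonsmooth hg hh ⟨z, fun hz' => hz ?_⟩
    rw [hobj]
    simp [hz']
  refine ⟨fun u s₀ δ hδ => ?_, fun u s₀ ⟨y, hy⟩ => ?_, ?_⟩
  · have hs : ∀ j, (PDFB.innerStep γ σ τ g h B u)^[j + 1] s₀
        = PDFB.innerStep γ σ τ g h B u ((PDFB.innerStep γ σ τ g h B u)^[j] s₀) :=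
      fun j => Function.iterate_succ_apply' _ _ _
    exact ⟨PDFB.exists_innerStep_norm_sub_sq_lt
        (s := fun j => (PDFB.innerStep γ σ τ g h B u)^[j] s₀) hγ hσ hτ hστ hg hh hN hs hδ,
      fun hfin => PDFB.exists_innerStep_gap_lt
        (s := fun j => (PDFB.innerStep γ σ τ g h B u)^[j] s₀) hγ hσ hτ hστ hg hh hN hfin hs hδ⟩
  · exact PDFB.tendsto_innerStep_of_gap_eq_zero
      (s := fun j => (PDFB.innerStep γ σ τ g h B u)^[j] s₀) hγ hσ hτ hστ hg hh hN hy
      fun j => Function.iterate_succ_apply' _ _ _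
  · intro x0 xbar0 y0 δ hδ hsum x u s hgen
    obtain ⟨β, hβ, hT⟩ :=
      PDFB.isAveraged_forwardBackward hf_conv hf_diff hL hf_lip hN hγ hγL
    -- The outer step differs from the exact forward-backward step by at most √2·√(δ k), whichever
    -- exit was taken.
    have herr : Summable fun k =>
        ‖x (k + 1) - PDFB.prox γ (PDFB.nonsmooth g h B) (x k - γ • gradient f (x k))‖ := by
      refine Summable.of_nonneg_of_le (fun _ => norm_nonneg _) (fun k => ?_)
        (hsum.mul_left (√2))
      rw [← hgen.forward k]
      exact (hgen.output k).norm_sub_le hγ hσ hτ hστ hg hh hN (hgen.inner_step k) (hδ k)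
    obtain ⟨z, hz⟩ := hsol
    rw [hobj] at hz ⊢
    obtain ⟨xs, hxs, hweak⟩ := hT.exists_weaklyTendsto hβ herr
      ⟨z, (PDFB.prox_forward_eq_iff hf_conv hf_diff hN hγ).2 hz⟩
    exact ⟨xs, (PDFB.prox_forward_eq_iff hf_conv hf_diff hN hγ).1 hxs, hweak,
      fun _ => hweak.tendsto⟩
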